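/- Let $E$ be a real Fréchet space whose topology is defined by seminorms $\{\|\cdot\|_n\}_{n\in\mathbb N}$, and let $\{e_k\}_{k\in\mathbb N}$ be an unconditional Schauder basis of $E$: every $x\in E$ has a unique expansion $x=\sum_k x_ke_k$ convergent in $E$, and for every permutation $\pi$ of $\mathbb N$ the series $\sum_k x_{\pi(k)}e_{\pi(k)}$ converges to $x$ too. Write $e^k(x)=x_k$, and $x\ll y$ if $x_k\le y_k$ for all $k$. For a nonempty $V\subset E$ put $\sup V=\sum_k v_k^*e_k$ with $v_k^*=\sup\{e^k(v)\mid v\in V\}$; it is well defined if all the $v_k^*$ are finite and the series converges in $E$. A function $g:E\to\mathbb R$ is left continuous if $g(x_j)\to g(x')$ whenever $x_j\to x'$ and $x_j\ll x_{j+1}$ for all $j$. A function $g$ from a measure space to $E$ is integrable if it has an approximating sequence: a sequence of step functions $g_n$ (finitely many values, measurable level sets, nonzero only on a set of finite measure) such that $\int\|g_n-g_m\|_s\to0$ as $n,m\to\infty$ for every $s$, and $g_n\to g$ almost everywhere; its integral is then $\lim_n\int g_n$. Let $T>0$, $I_T=[0,T]$ with Lebesgue measure, $\hat x\in E$ and $f:I_T\times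 E\to E$, $f=\sum_k f_ke_k$, be such that: 1. each $f_k(t,\cdot)$, $t\in I_T$, is left continuous; 2. $t\mapsto f(t,x)$ is integrable on $I_T$ for every $x\in E$; 3. there is $C\in E$ with $f(t,x)\ll C$ for all $(t,x)\in I_T\times E$; 4. there is $x_*\in E$ with $x_*\ll\hat x+\int_0^tf(\xi,x_*)\,d\xi$ for all $t\in I_T$; 5. $x\ll y$ implies $f(t,x)\ll f(t,y)$ for all $x,y\in E$, $t\in I_T$. A solution (of $\dot x=f(t,x)$, $x(0)=\hat x$) is a function $x\in C(I_T,E)$ such that $t\mapsto f(t,x(t))$ is integrable on $I_T$ and $x(t)=\hat x+\int_0^tf(\xi,x(\xi))\,d\xi$ for all $t\in I_T$. Let $Q$ be the set of all solutions and $Q(t)=\{v(t)\mid v\in Q\}$. Let $S$ be the set of all functions $u:I_T\to E$ whose coordinates $u_k$ are lower semicontinuous, for which $t\mapsto f(t,u(t))$ is integrable on $I_T$, and which satisfy $x_*\ll u(t)\ll\hat x+\int_0^tf(\xi,u(\xi))\,d\xi$ for all $t\in I_T$; put $S(t)=\{u(t)\mid u\in S\}$. Then for each $t\in I_T$ the set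 $Q(t)$ is nonempty and the element $\overline x(t)=\sup Q(t)\in E$ is well defined. The function $\overline x$ is itself a solution, and it is the maximal one: $v(t)\ll\overline x(t)$ for every solution $v$ and every $t\in I_T$. Moreover, $\sup S(t)$ is well defined and $\overline x(t)=\sup S(t)$ for every $t\in I_T$. -/

import Mathlib

open Set Filter Topology MeasureTheory

noncomputable section

namespace FrechetIVP

section Basis

variable {E : Type*} [AddCommGroup E] [Module ℝ E] [TopologicalSpace E]

/-- `x = ∑ₖ cₖ eₖ`: the partial sums of the series converge to `x` in the topology of `E`. -/
def HasExpansion (e : ℕ → E) (c : ℕ → ℝ) (x : E) : Prop :=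
  Tendsto (fun n : ℕ => ∑ k ∈ Finset.range n, c k • e k) atTop (𝓝 x)

/-- `e` is a Schauder basis: every vector has a unique expansion. No continuity of the coordinate
functionals is required. -/
def IsSchauderBasis (e : ℕ → E) : Prop :=
  ∀ x : E, ∃! c : ℕ → ℝ, HasExpansion e c x

/-- The `k`-th coordinate `eᵏ(x)` of `x`. -/
def IsSchauderBasis.coord {e : ℕ → E} (he : IsSchauderBasis e) (k : ℕ) (x : E) : ℝ :=
  (he x).choose k

theorem IsSchauderBasis.hasExpansion_coord {e : ℕ → E} (he : IsSchauderBasis e) (x : E) :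
    HasExpansion e (fun k => he.coord k x) x :=
  (he x).choose_spec.1

/-- The basis is unconditional: every rearrangement of the expansion of a vector `x` still
converges to `x`. -/
def IsSchauderBasis.IsUnconditional {e : ℕ → E} (he : IsSchauderBasis e) : Prop :=
  ∀ (x : E) (π : Equiv.Perm ℕ),
    HasExpansion (fun k => e (π k)) (fun k => he.coord (π k) x) x

/-- The coordinatewise partial order `x ≪ y`. -/
def IsSchauderBasis.le {e : ℕ → E} (he : IsSchauderBasis e) (x y : E) : Prop :=
  ∀ k : ℕ, he.coord k x ≤ he.coord k y

/-- `y = sup V`: each number `v*ₖ = sup {eᵏ(v) | v ∈ V}` is a genuine (finite) supremum, and the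
series `∑ₖ v*ₖ eₖ` converges to `y`. -/
def IsSchauderBasis.HasSup {e : ℕ → E} (he : IsSchauderBasis e) (V : Set E) (y : E) : Prop :=
  ∃ v : ℕ → ℝ, (∀ k, IsLUB (he.coord k '' V) (v k)) ∧ HasExpansion e v y

/-- Left continuity of a real function on `E`: continuity along increasing convergent sequences. -/
def IsSchauderBasis.LeftContinuous {e : ℕ → E} (he : IsSchauderBasis e) (g : E → ℝ) : Prop :=
  ∀ (x' : E) (x : ℕ → E), Tendsto x atTop (𝓝 x') → (∀ k, he.le (x k) (x (k + 1))) →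
    Tendsto (fun k => g (x k)) atTop (𝓝 (g x'))

end Basis

section Integral

variable {E : Type*} [AddCommGroup E] [Module ℝ E] [TopologicalSpace E]
variable {α : Type*} [MeasurableSpace α]

/-- The integral of a step function, `∑ₐ μ(f = a) a`. -/
def stepIntegral (μ : Measure α) (f : SimpleFunc α E) : E :=
  ∑ a ∈ f.range, μ.real (f ⁻¹' {a}) • a

/-- `F` is an approximating sequence for `g`: step functions, supported on sets of finite measure,
that are Cauchy for all the `L¹`-seminorms `∫ ‖·‖ₛ` and converge to `g` almost everywhere. -/
def IsApproximating (p : ℕ → Seminorm ℝ E) (μ : Measure α) (F : ℕ → SimpleFunc α E)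
    (g : α → E) : Prop :=
  (∀ n, (F n).FinMeasSupp μ) ∧
  (∀ s : ℕ, ∀ ε : ℝ, 0 < ε → ∃ l : ℕ, ∀ i m : ℕ, l < i → l < m →
    ∫⁻ t, ENNReal.ofReal (p s (F i t - F m t)) ∂μ < ENNReal.ofReal ε) ∧
  (∀ᵐ t ∂μ, Tendsto (fun n => F n t) atTop (𝓝 (g t)))

/-- Integrability of a function with values in a Fréchet space with the seminorms `p`. -/
def FIntegrable (p : ℕ → Seminorm ℝ E) (μ : Measure α) (g : α → E) : Prop :=
  ∃ F : ℕ → SimpleFunc α E, IsApproximating p μ F g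

/-- `I` is the integral of `g`: the limit of the integrals of an approximating sequence. -/
def HasFIntegral (p : ℕ → Seminorm ℝ E) (μ : Measure α) (g : α → E) (I : E) : Prop :=
  ∃ F : ℕ → SimpleFunc α E, IsApproximating p μ F g ∧
    Tendsto (fun n => stepIntegral μ (F n)) atTop (𝓝 I)

open Classical in
/-- The integral of `g` (with the value `0` if `g` has no integral). -/
def fIntegral (p : ℕ → Seminorm ℝ E) (μ : Measure α) (g : α → E) : E :=
  if h : ∃ I, HasFIntegral p μ g I then h.choose else 0

end Integral

section Problem

variable {E : Type*} [AddCommGroup E] [Module ℝ E] [TopologicalSpace E]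

/-- Integrability on the interval `I_T = [0, T]`. -/
def IntegrableUpTo (p : ℕ → Seminorm ℝ E) (T : ℝ) (g : ℝ → E) : Prop :=
  FIntegrable p (volume.restrict (Icc 0 T)) g

/-- `∫₀ᵗ g(ξ) dξ`, for `0 ≤ t`. -/
def integralUpTo (p : ℕ → Seminorm ℝ E) (t : ℝ) (g : ℝ → E) : E :=
  fIntegral p (volume.restrict (Icc 0 t)) g

/-- `Φ(u)(t) = x̂ + ∫₀ᵗ f(ξ, u(ξ)) dξ`. -/
def picard (p : ℕ → Seminorm ℝ E) (f : ℝ → E → E) (x₀ : E) (u : ℝ → E) (t : ℝ) : E :=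
  x₀ + integralUpTo p t (fun ξ => f ξ (u ξ))

/-- `x` is a solution on `[0, T]` of `ẋ = f(t, x)`, `x(0) = x₀`, in the integral sense.
Only the values of `x` on `[0, T]` matter. -/
structure IsSolution (p : ℕ → Seminorm ℝ E) (T : ℝ) (f : ℝ → E → E) (x₀ : E) (x : ℝ → E) :
    Prop where
  continuousOn : ContinuousOn x (Icc 0 T)
  integrable : IntegrableUpTo p T (fun t => f t (x t))
  eq_picard : ∀ t ∈ Icc 0 T, x t = picard p f x₀ x t

/-- The functions `u` on `[0, T]` with lower semicontinuous coordinates, with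
`t ↦ f(t, u(t))` integrable, and with `x_* ≪ u(t) ≪ Φ(u)(t)` on `[0, T]`. -/
structure IsSubsolution {e : ℕ → E} (he : IsSchauderBasis e) (p : ℕ → Seminorm ℝ E) (T : ℝ)
    (f : ℝ → E → E) (x₀ xs : E) (u : ℝ → E) : Prop where
  lsc : ∀ k, LowerSemicontinuousOn (fun t => he.coord k (u t)) (Icc 0 T)
  integrable : IntegrableUpTo p T (fun t => f t (u t))
  lower : ∀ t ∈ Icc 0 T, he.le xs (u t)
  upper : ∀ t ∈ Icc 0 T, he.le (u t) (picard p f x₀ u t)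

end Problem

end FrechetIVP

end

/-!
The maximal solution is found as in the Knaster–Tarski theorem. Let `Φ(u)(t) = x₀ + ∫₀ᵗ f(ξ, u(ξ))
dξ`; this operator is increasing, since `f(t, ·)` is. Let `x̄(t)` be the coordinatewise supremum
of all subsolutions `u` (those with `x_* ≪ u ≪ Φ(u)`). Its coordinates lie between those of `x_*`
and `x₀ + t C`, so the supremum exists in `E`, and they are lower semicontinuous, being suprema of
lower semicontinuous functions. Hence `f(·, x̄(·))` is integrable, `x̄ ≪ Φ(x̄)`, and `x̄` is
itself a subsolution. Then so is the continuous function `Φ(x̄)`, whence `Φ(x̄) ≪ x̄` and `x̄ =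
Φ(x̄)`. If `v` is any solution, then `max(x_*, v)` is a subsolution, so `v ≪ x̄`.

Three facts about `E` carry this argument.

* The coordinate functionals and the unconditional majorants `x ↦ sup_F p (∑ k ∈ F, xₖ eₖ)` of the
  defining seminorms are continuous (`IsUnconditional.continuous_uncSeminorm`). The majorants are
  finite since unconditional series are summable (`summable_of_forall_perm`), they make `E` complete
  (`IsUnconditional.complete_uncSeminorm`), and Baire's theorem gives continuity
  (`continuous_of_complete_finer`). Consequently order intervals contain every element their
  coordinates allow, and convergence in them is coordinatewise
  (`IsUnconditional.exists_coord_eq`, `IsUnconditional.tendsto_of_tendsto_coord`).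
* The integral exists and commutes with the coordinates (`IsUnconditional.coord_fIntegral`), and a
  function with measurable coordinates between an integrable function and a constant is integrable
  (`IsUnconditional.fIntegrable_of_le_of_le`).
* If `u` has measurable coordinates and is bounded below, then `f(·, u(·))` has measurable
  coordinates (`IsUnconditional.aemeasurable_superposition`). This is where left continuity is
  used: `u` is the limit of an increasing sequence of functions with countably many values.
-/

noncomputable section

namespace FrechetIVP

/-! ### Finer complete seminorms on a Fréchet space -/

section FinerSeminorms

variable {E : Type*} [AddCommGroup E] [Module ℝ E] [UniformSpace E] [IsUniformAddGroup E]

theorem isCountablyGenerated_uniformity {p : ℕ → Seminorm ℝ E}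
    (hp : WithSeminorms (p : SeminormFamily ℝ E ℕ)) : (uniformity E).IsCountablyGenerated := by
  have := hp.firstCountableTopology
  exact IsUniformAddGroup.uniformity_countably_generated

variable [ContinuousSMul ℝ E] [CompleteSpace E]

/-- By Baire's theorem, the closure of a ball of any (possibly discontinuous) seminorm is a
neighbourhood of zero. -/
theorem closure_ball_mem_nhds_zero {p : ℕ → Seminorm ℝ E}
    (hp : WithSeminorms (p : SeminormFamily ℝ E ℕ)) (q : Seminorm ℝ E) {ε : ℝ} (hε : 0 < ε) :
    closure {x : E | q x < ε} ∈ 𝓝 (0 : E) := by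
  have := isCountablyGenerated_uniformity hp
  obtain ⟨n, x₀, hx₀⟩ := nonempty_interior_of_iUnion_of_closed
    (f := fun n : ℕ => closure {x : E | q x < (n + 1) * (ε / 2)}) (fun _ => isClosed_closure) (by
      refine eq_univ_of_forall fun x => mem_iUnion.2 ?_
      obtain ⟨n, hn⟩ := exists_nat_gt (q x / (ε / 2))
      refine ⟨n, subset_closure ?_⟩
      rw [div_lt_iff₀ (by positivity)] at hn
      exact hn.trans_le (by gcongr; linarith))
  have hc : (0 : ℝ) < n + 1 := by positivity
  have hcont : Continuous fun z : E => x₀ + ((n : ℝ) + 1) • z := by fun_prop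
  have hmem : (fun z : E => x₀ + ((n : ℝ) + 1) • z) ⁻¹'
      interior (closure {x : E | q x < (n + 1) * (ε / 2)}) ∈ 𝓝 (0 : E) :=
    hcont.continuousAt.preimage_mem_nhds (by simpa using isOpen_interior.mem_nhds hx₀)
  filter_upwards [hmem] with z hz
  have key := map_mem_closure₂ (u := {x : E | q x < ε})
    (f := fun a b : E => ((n : ℝ) + 1)⁻¹ • (a - b)) (by fun_prop)
    (interior_subset hz) (interior_subset hx₀) (fun a ha b hb => by
      simp only [mem_ofPred_eq] at ha hb ⊢
      rw [map_smul_eq_mul, Real.norm_of_nonneg (by positivity), inv_mul_lt_iff₀ hc]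
      calc q (a - b) ≤ q a + q b := map_sub_le_add q a b
        _ < (n + 1) * (ε / 2) + (n + 1) * (ε / 2) := add_lt_add ha hb
        _ = (n + 1) * ε := by ring)
  simpa [smul_smul, inv_mul_cancel₀ hc.ne'] using key

/-- A form of the open mapping theorem: if a Fréchet space is also sequentially complete for a
finer increasing sequence of seminorms `q`, then these seminorms are continuous. -/
theorem continuous_of_complete_finer [T2Space E] {p q : ℕ → Seminorm ℝ E}
    (hp : WithSeminorms (p : SeminormFamily ℝ E ℕ)) (hq : Monotone q)
    (hpq : ∀ s, p s ≤ q s)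
    (hcomp : ∀ x : ℕ → E,
      (∀ s, ∀ ε : ℝ, 0 < ε → ∃ N, ∀ m, N ≤ m → ∀ n, N ≤ n → q s (x m - x n) ≤ ε) →
      ∃ y, ∀ s, ∀ ε : ℝ, 0 < ε → ∃ N, ∀ n, N ≤ n → q s (x n - y) ≤ ε) (s : ℕ) :
    Continuous (q s) := by
  have hbig : ∀ ε : ℝ, 0 < ε → ∀ x ∈ closure {x : E | q s x < ε / 2}, q s x ≤ 2 * ε := by
    intro ε hε x hx
    -- `x` is expanded into a series whose `n`-th term lies in the `q (s + n)`-ball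
    -- of radius `ε / 2 ^ (n + 1)`.
    set U : ℕ → Set E := fun n => {x : E | q (s + n) x < ε / 2 ^ (n + 1)} with hU
    have hstep : ∀ n x, ∃ y, x ∈ closure (U n) → y ∈ U n ∧ x - y ∈ closure (U (n + 1)) := by
      intro n x
      by_cases hx : x ∈ closure (U n)
      · have h0 : closure (U (n + 1)) ∈ 𝓝 (x - x) := by
          rw [sub_self]
          exact closure_ball_mem_nhds_zero hp _ (by positivity)
        have hc : Continuous fun y : E => x - y := by fun_prop
        obtain ⟨y, hy1, hy2⟩ := mem_closure_iff_nhds.1 hx _ (hc.continuousAt.preimage_mem_nhds h0)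
        exact ⟨y, fun _ => ⟨hy2, hy1⟩⟩
      · exact ⟨0, fun h => absurd h hx⟩
    choose Y hY using hstep
    let X : ℕ → E := fun n => Nat.rec x (fun n x => x - Y n x) n
    have hX0 : X 0 = x := rfl
    have hXs : ∀ n, X (n + 1) = X n - Y n (X n) := fun _ => rfl
    have hXmem : ∀ n, X n ∈ closure (U n) := by
      intro n
      induction n with
      | zero => simpa [hX0, hU] using hx
      | succ n ih => rw [hXs]; exact (hY n _ ih).2
    have hdiff : ∀ r n k, r ≤ s + n → q r (X n - X (n + k)) ≤ ε / 2 ^ n - ε / 2 ^ (n + k) := by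
      intro r n k hr
      induction k with
      | zero => simp
      | succ k ih =>
        have h1 : X n - X (n + (k + 1)) = (X n - X (n + k)) + Y (n + k) (X (n + k)) := by
          rw [← add_assoc, hXs]; abel
        have h2 : q r (Y (n + k) (X (n + k))) < ε / 2 ^ (n + k + 1) :=
          lt_of_le_of_lt (hq (by omega : r ≤ s + (n + k)) _) (hY _ _ (hXmem _)).1
        have h3 : ε / 2 ^ (n + k) = ε / 2 ^ (n + k + 1) + ε / 2 ^ (n + k + 1) := by
          rw [pow_succ]; field_simp; ring
        rw [h1]
        refine (map_add_le_add _ _ _).trans ?_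
        rw [← add_assoc n k 1]
        linarith
    have hpow : ∀ δ : ℝ, 0 < δ → ∃ N : ℕ, ∀ n, N ≤ n → ε / 2 ^ n ≤ δ := by
      intro δ hδ
      have : Tendsto (fun n : ℕ => ε / 2 ^ n) atTop (𝓝 0) := by
        simpa [div_eq_mul_inv] using
          (tendsto_pow_atTop_nhds_zero_of_lt_one (r := (2 : ℝ)⁻¹) (by norm_num)
            (by norm_num)).const_mul ε
      exact eventually_atTop.1 (this.eventually_le_const hδ)
    have hle : ∀ r N m, r ≤ s + N → N ≤ m → q r (X N - X m) ≤ ε / 2 ^ N := by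
      intro r N m hr hm
      obtain ⟨k, rfl⟩ := Nat.exists_eq_add_of_le hm
      exact (hdiff r N k hr).trans (sub_le_self _ (by positivity))
    obtain ⟨y, hy⟩ := hcomp (fun n => x - X n) (by
      intro r δ hδ
      obtain ⟨N, hN⟩ := hpow (δ / 2) (by positivity)
      refine ⟨max N r, fun m hm n hn => ?_⟩
      have h1 : x - X m - (x - X n) = (X (max N r) - X m) - (X (max N r) - X n) := by abel
      have h2 := hle r (max N r) m (by omega) hm
      have h3 := hle r (max N r) n (by omega) hn
      have h4 := hN (max N r) (le_max_left _ _)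
      rw [h1]
      refine (map_sub_le_add _ _ _).trans ?_
      linarith)
    have hpX : ∀ r n, r ≤ s + n → p r (X n) ≤ ε / 2 ^ n := by
      intro r n hr
      have hcl : closure (U n) ⊆ {z | p r z ≤ ε / 2 ^ n} := by
        refine closure_minimal (fun z hz => ?_)
          (isClosed_le (hp.continuous_seminorm r) continuous_const)
        have hz' : q (s + n) z < ε / 2 ^ (n + 1) := hz
        have : ε / 2 ^ (n + 1) ≤ ε / 2 ^ n := by
          gcongr
          · norm_num
          · omega
        exact ((hpq r z).trans (hq hr z)).trans (hz'.le.trans this)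
      exact hcl (hXmem n)
    have hxy : x = y := by
      by_contra hne
      obtain ⟨r, hr⟩ := hp.separating_of_T1 (x - y) (sub_ne_zero.2 hne)
      have hpos : 0 < p r (x - y) := lt_of_le_of_ne (apply_nonneg _ _) (Ne.symm hr)
      obtain ⟨N₁, hN₁⟩ := hy r (p r (x - y) / 3) (by positivity)
      obtain ⟨N₂, hN₂⟩ := hpow (p r (x - y) / 3) (by positivity)
      set n := max (max N₁ N₂) r
      have h1 := hN₁ n ((le_max_left _ _).trans (le_max_left _ _))
      have h2 := hN₂ n ((le_max_right _ _).trans (le_max_left _ _))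
      have h3 := hpX r n ((le_max_right _ _).trans (Nat.le_add_left _ _))
      have h4 : p r (x - y) ≤ p r (X n) + p r (x - X n - y) := by
        have : x - y = X n + (x - X n - y) := by abel
        conv_lhs => rw [this]
        exact map_add_le_add _ _ _
      have h5 := hpq r (x - X n - y)
      linarith
    obtain ⟨N, hN⟩ := hy s ε hε
    have h1 := hN N le_rfl
    have h3 : q s (x - X N) ≤ ε := by
      have := hle s 0 N le_rfl (Nat.zero_le N)
      rwa [hX0, pow_zero, div_one] at this
    have h4 : q s x ≤ q s (x - X N) + q s (x - X N - y) := by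
      have hx0 : x = (x - X N) - (x - X N - y) := by rw [hxy]; abel
      calc q s x = q s ((x - X N) - (x - X N - y)) := by rw [← hx0]
        _ ≤ _ := map_sub_le_add _ _ _
    linarith
  refine Seminorm.continuous' (r := 2) (mem_of_superset
    (closure_ball_mem_nhds_zero hp (q s) (by norm_num : (0 : ℝ) < 1 / 2)) fun x hx => ?_)
  rw [Seminorm.mem_closedBall_zero]
  simpa using hbig 1 one_pos x hx

end FinerSeminorms

/-! ### Unconditional series -/

section UnconditionalSeries

/-- The natural numbers can be enumerated in the order of an injective key. -/
theorem exists_perm_of_key (κ : ℕ → ℕ) (hκ : Function.Injective κ) :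
    ∃ π : Equiv.Perm ℕ, ∀ (c : ℕ) (D : Finset ℕ), (∀ k, k ∈ D ↔ κ k < c) →
      (Finset.range D.card).map π.toEmbedding = D := by
  classical
  have : Infinite (range κ) := (infinite_range_of_injective hκ).to_subtype
  let o := Nat.Subtype.orderIsoOfNat (range κ)
  let π : Equiv.Perm ℕ := o.toEquiv.trans (Equiv.ofInjective κ hκ).symm
  have hπ : ∀ i, κ (π i) = o i := fun i =>
    congrArg Subtype.val ((Equiv.ofInjective κ hκ).apply_symm_apply (o i))
  have hmono : StrictMono fun i => κ (π i) := by
    intro i j hij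
    simp only [hπ]
    exact_mod_cast o.strictMono hij
  refine ⟨π, fun c D hD => ?_⟩
  have hex : ∃ i, ¬ κ (π i) < c := ⟨c, not_lt.2 (hmono.le_apply (x := c))⟩
  have hm : ∀ i, i < Nat.find hex ↔ κ (π i) < c := by
    refine fun i => ⟨fun h => not_not.1 (Nat.find_min hex h), fun h => ?_⟩
    by_contra hle
    exact Nat.find_spec hex ((hmono.monotone (not_lt.1 hle)).trans_lt h)
  have hmap : (Finset.range (Nat.find hex)).map π.toEmbedding = D := by
    ext k
    simp only [Finset.mem_map, Finset.mem_range, Equiv.coe_toEmbedding]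
    rw [hD]
    constructor
    · rintro ⟨i, hi, rfl⟩
      exact (hm i).1 hi
    · intro hk
      refine ⟨π.symm k, (hm _).2 ?_, ?_⟩ <;> simp [hk]
  have hcard : D.card = Nat.find hex := by rw [← hmap]; simp
  rw [hcard, hmap]

/-- A series all of whose rearrangements converge is summable. If it were not, there would be
successive blocks `G` of indices with sums far from zero; the rearrangement that lists the elements
of each such block contiguously would have partial sums that are not Cauchy. -/
theorem summable_of_forall_perm {E : Type*} [AddCommGroup E] [UniformSpace E]
    [IsUniformAddGroup E] [CompleteSpace E] (z : ℕ → E)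
    (h : ∀ π : Equiv.Perm ℕ, ∃ y,
      Tendsto (fun n => ∑ k ∈ Finset.range n, z (π k)) atTop (𝓝 y)) : Summable z := by
  classical
  rw [summable_iff_vanishing]
  by_contra hcon
  push Not at hcon
  obtain ⟨U, hU, hcon⟩ := hcon
  choose G hGd hGU using fun n => hcon (Finset.range n)
  -- `N j` separates the `j`-th block from the previous ones.
  let N : ℕ → ℕ := fun j => Nat.rec 0 (fun _ n => max ((G n).sup id) n + 1) j
  have hNs : ∀ j, N (j + 1) = max ((G (N j)).sup id) (N j) + 1 := fun _ => rfl
  have hNmono : StrictMono N := strictMono_nat_of_lt_succ fun j => by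
    rw [hNs]; exact Nat.lt_succ_of_le (le_max_right _ _)
  have hGlt : ∀ j k, k ∈ G (N j) → N j ≤ k ∧ k < N (j + 1) := by
    intro j k hk
    constructor
    · by_contra hlt
      exact Finset.disjoint_left.1 (hGd (N j)) hk (Finset.mem_range.2 (not_le.1 hlt))
    · rw [hNs]
      exact Nat.lt_succ_of_le ((Finset.le_sup (f := id) hk).trans (le_max_left _ _))
  have hblock : ∀ k, ∃ j, N j ≤ k ∧ k < N (j + 1) := by
    intro k
    have hex : ∃ j, k < N (j + 1) := ⟨k, lt_of_lt_of_le (Nat.lt_succ_self k)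
      (hNmono.le_apply (x := k + 1))⟩
    refine ⟨Nat.find hex, ?_, Nat.find_spec hex⟩
    rcases hj : Nat.find hex with _ | i
    · exact Nat.zero_le _
    · exact not_lt.1 (Nat.find_min hex (m := i) (by omega))
  choose J hJ1 hJ2 using hblock
  have hJu : ∀ j k, N j ≤ k → k < N (j + 1) → J k = j := by
    intro j k h1 h2
    have h3 : J k < j + 1 := hNmono.lt_iff_lt.1 ((hJ1 k).trans_lt h2)
    have h4 : j < J k + 1 := hNmono.lt_iff_lt.1 (h1.trans_lt (hJ2 k))
    omega
  -- Inside the `j`-th block, the elements of `G (N j)` get the smaller keys.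
  let κ : ℕ → ℕ := fun k => if k ∈ G (N (J k)) then N (J k) + k else N (J k + 1) + k
  have hκlo : ∀ k, 2 * N (J k) ≤ κ k := by
    intro k
    have := hJ1 k
    have := hNmono (Nat.lt_succ_self (J k))
    simp only [κ]
    split_ifs <;> simp only [Nat.succ_eq_add_one] at * <;> omega
  have hκhi : ∀ k, κ k < 2 * N (J k + 1) := by
    intro k
    have := hJ2 k
    have := hNmono (Nat.lt_succ_self (J k))
    simp only [κ]
    split_ifs <;> simp only [Nat.succ_eq_add_one] at * <;> omega
  have hJκ : ∀ k l, κ k = κ l → J k = J l := by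
    intro k l hkl
    have h1 : N (J k) < N (J l + 1) := by
      have := hκlo k; have := hκhi l; omega
    have h2 : N (J l) < N (J k + 1) := by
      have := hκlo l; have := hκhi k; omega
    have h3 : J k < J l + 1 := hNmono.lt_iff_lt.1 h1
    have h4 : J l < J k + 1 := hNmono.lt_iff_lt.1 h2
    omega
  have hκinj : Function.Injective κ := by
    intro k l hkl
    have hJkl := hJκ k l hkl
    have h1 := hJ1 k
    have h2 := hJ2 k
    have h3 := hJ1 l
    have h4 := hJ2 l
    rw [← hJkl] at h3 h4
    simp only [κ, ← hJkl] at hkl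
    split_ifs at hkl <;> omega
  obtain ⟨π, hπ⟩ := exists_perm_of_key κ hκinj
  have hD1 : ∀ j k, k ∈ Finset.range (N j) ↔ κ k < 2 * N j := by
    intro j k
    rw [Finset.mem_range]
    constructor
    · intro hk
      have h1 : J k < j := hNmono.lt_iff_lt.1 ((hJ1 k).trans_lt hk)
      have h2 : N (J k + 1) ≤ N j := hNmono.monotone h1
      have := hκhi k
      omega
    · intro hk
      have h1 : J k < j := hNmono.lt_iff_lt.1 (by have := hκlo k; omega)
      exact (hJ2 k).trans_le (hNmono.monotone h1)
  have hD2 : ∀ j k, k ∈ Finset.range (N j) ∪ G (N j) ↔ κ k < N j + N (j + 1) := by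
    intro j k
    have hlt := hNmono (Nat.lt_succ_self j)
    simp only [Nat.succ_eq_add_one] at hlt
    rw [Finset.mem_union, hD1]
    constructor
    · rintro (hk | hk)
      · omega
      · have h1 := hGlt j k hk
        have h2 := hJu j k h1.1 h1.2
        simp only [κ, h2, if_pos hk]
        omega
    · intro hk
      by_cases h1 : κ k < 2 * N j
      · exact Or.inl h1
      · right
        have h2 : ¬ k < N j := fun h => h1 ((hD1 j k).1 (Finset.mem_range.2 h))
        have h3 : k < N (j + 1) :=
          Finset.mem_range.1 ((hD1 (j + 1) k).2 (by omega))
        have h4 := hJu j k (not_lt.1 h2) h3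
        by_contra h5
        simp only [κ, h4, if_neg h5] at hk
        omega
  obtain ⟨y, hy⟩ := h π
  have hsum : ∀ D : Finset ℕ, (Finset.range D.card).map π.toEmbedding = D →
      ∑ k ∈ Finset.range D.card, z (π k) = ∑ k ∈ D, z k := by
    intro D hD
    conv_rhs => rw [← hD]
    rw [Finset.sum_map]
    rfl
  have hcard1 : ∀ j, j ≤ (Finset.range (N j)).card := fun j => by
    rw [Finset.card_range]; exact hNmono.le_apply
  have hcard2 : ∀ j, j ≤ (Finset.range (N j) ∪ G (N j)).card := fun j =>
    (hcard1 j).trans (Finset.card_le_card Finset.subset_union_left)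
  have hl1 := hy.comp (tendsto_atTop_mono hcard1 tendsto_id)
  have hl2 := hy.comp (tendsto_atTop_mono hcard2 tendsto_id)
  have hl := hl2.sub hl1
  rw [sub_self] at hl
  obtain ⟨j, hj⟩ := (hl.eventually_mem hU).exists
  refine hGU (N j) ?_
  simp only [Function.comp_apply] at hj
  rw [hsum _ (hπ _ _ (hD2 j)), hsum _ (hπ _ _ (hD1 j)),
    Finset.sum_union (hGd (N j)).symm, add_sub_cancel_left] at hj
  exact hj

end UnconditionalSeries

/-! ### Unconditional bases -/

section Coordinates

variable {E : Type*} [AddCommGroup E] [Module ℝ E] [TopologicalSpace E] {e : ℕ → E}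

theorem HasExpansion.coord_eq {c : ℕ → ℝ} {x : E} (h : HasExpansion e c x)
    (he : IsSchauderBasis e) (k : ℕ) : he.coord k x = c k :=
  congrFun ((he x).unique (he.hasExpansion_coord x) h) k

namespace IsSchauderBasis

theorem hasSup_of_forall_isLUB (he : IsSchauderBasis e) {V : Set E} {y : E}
    (h : ∀ k, IsLUB (he.coord k '' V) (he.coord k y)) : he.HasSup V y :=
  ⟨fun k => he.coord k y, h, he.hasExpansion_coord y⟩

theorem ext_coord [T2Space E] (he : IsSchauderBasis e) {x y : E}
    (h : ∀ k, he.coord k x = he.coord k y) : x = y := by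
  have hx := he.hasExpansion_coord x
  rw [funext h] at hx
  exact tendsto_nhds_unique hx (he.hasExpansion_coord y)

theorem coord_basis (he : IsSchauderBasis e) (k j : ℕ) :
    he.coord k (e j) = if k = j then 1 else 0 := by
  refine HasExpansion.coord_eq (c := fun k => if k = j then 1 else 0) ?_ he k
  refine tendsto_const_nhds.congr' ?_
  filter_upwards [eventually_gt_atTop j] with n hn
  simp [hn]

variable [IsTopologicalAddGroup E] [ContinuousSMul ℝ E]

/-- The `k`-th coordinate as a linear form. -/
def coordLM (he : IsSchauderBasis e) (k : ℕ) : E →ₗ[ℝ] ℝ where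
  toFun := he.coord k
  map_add' x y := by
    refine HasExpansion.coord_eq (c := fun k => he.coord k x + he.coord k y) ?_ he k
    simpa only [HasExpansion, add_smul, Finset.sum_add_distrib] using
      (he.hasExpansion_coord x).add (he.hasExpansion_coord y)
  map_smul' r x := by
    refine HasExpansion.coord_eq (c := fun k => r * he.coord k x) ?_ he k
    simpa only [HasExpansion, mul_smul, Finset.smul_sum] using
      (he.hasExpansion_coord x).const_smul r

theorem coord_add (he : IsSchauderBasis e) (k : ℕ) (x y : E) :
    he.coord k (x + y) = he.coord k x + he.coord k y :=
  (he.coordLM k).map_add x y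

theorem coord_sub (he : IsSchauderBasis e) (k : ℕ) (x y : E) :
    he.coord k (x - y) = he.coord k x - he.coord k y :=
  (he.coordLM k).map_sub x y

theorem coord_smul (he : IsSchauderBasis e) (k : ℕ) (r : ℝ) (x : E) :
    he.coord k (r • x) = r * he.coord k x :=
  (he.coordLM k).map_smul r x

theorem coord_zero (he : IsSchauderBasis e) (k : ℕ) : he.coord k (0 : E) = 0 :=
  (he.coordLM k).map_zero

theorem coord_sum (he : IsSchauderBasis e) (k : ℕ) {ι : Type*} (F : Finset ι) (x : ι → E) :
    he.coord k (∑ i ∈ F, x i) = ∑ i ∈ F, he.coord k (x i) :=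
  map_sum (he.coordLM k) x F

theorem coord_sum_smul_basis (he : IsSchauderBasis e) (k : ℕ) (F : Finset ℕ) (c : ℕ → ℝ) :
    he.coord k (∑ j ∈ F, c j • e j) = if k ∈ F then c k else 0 := by
  simp [coord_sum, coord_smul, coord_basis]

theorem basis_ne_zero (he : IsSchauderBasis e) (k : ℕ) : e k ≠ 0 := by
  intro h
  have h1 := he.coord_basis k k
  rw [h, coord_zero] at h1
  simp at h1

/-- The coordinate projection `x ↦ ∑ k ∈ F, xₖ eₖ`. -/
def proj (he : IsSchauderBasis e) (F : Finset ℕ) : E →ₗ[ℝ] E :=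
  ∑ k ∈ F, (he.coordLM k).smulRight (e k)

theorem proj_apply (he : IsSchauderBasis e) (F : Finset ℕ) (x : E) :
    he.proj F x = ∑ k ∈ F, he.coord k x • e k := by
  simp [proj, coordLM]

theorem seminorm_le_of_proj_range_le (he : IsSchauderBasis e) {p : Seminorm ℝ E}
    (hp : Continuous p) {x : E} {M : ℝ}
    (h : ∀ n, p (he.proj (Finset.range n) x) ≤ M) : p x ≤ M := by
  refine le_of_tendsto ((hp.tendsto x).comp (he.hasExpansion_coord x)) (Eventually.of_forall ?_)
  intro n
  rw [Function.comp_apply, ← proj_apply]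
  exact h n

end IsSchauderBasis

end Coordinates

section Multipliers

variable {E : Type*} [AddCommGroup E] [Module ℝ E]

/-- A seminorm on a parallelepiped is maximal at a vertex. -/
theorem seminorm_add_sum_smul_le (p : Seminorm ℝ E) (z : ℕ → E) (M : ℝ) (c : ℕ → ℝ)
    (F : Finset ℕ) (hc : ∀ k ∈ F, c k ∈ Icc (0 : ℝ) 1) (w : E)
    (h : ∀ G ⊆ F, p (w + ∑ k ∈ G, z k) ≤ M) : p (w + ∑ k ∈ F, c k • z k) ≤ M := by
  classical
  induction F using Finset.induction_on generalizing w with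
  | empty => simpa using h ∅ le_rfl
  | insert a F ha ih =>
    have hcF : ∀ k ∈ F, c k ∈ Icc (0 : ℝ) 1 := fun k hk => hc k (Finset.mem_insert_of_mem hk)
    obtain ⟨h0, h1⟩ := hc a (Finset.mem_insert_self a F)
    have hA := ih hcF w fun G hG => h G (hG.trans (Finset.subset_insert a F))
    have hB := ih hcF (w + z a) fun G hG => by
      have := h (insert a G) (Finset.insert_subset_insert a hG)
      rwa [Finset.sum_insert fun hmem => ha (hG hmem), ← add_assoc] at this
    rw [Finset.sum_insert ha]
    have heq : w + (c a • z a + ∑ k ∈ F, c k • z k) =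
        (1 - c a) • (w + ∑ k ∈ F, c k • z k) + c a • (w + z a + ∑ k ∈ F, c k • z k) := by
      module
    rw [heq]
    calc p ((1 - c a) • (w + ∑ k ∈ F, c k • z k) + c a • (w + z a + ∑ k ∈ F, c k • z k))
        ≤ (1 - c a) * p (w + ∑ k ∈ F, c k • z k) + c a * p (w + z a + ∑ k ∈ F, c k • z k) := by
          refine (map_add_le_add _ _ _).trans_eq ?_
          rw [map_smul_eq_mul, map_smul_eq_mul, Real.norm_of_nonneg (sub_nonneg.2 h1),
            Real.norm_of_nonneg h0]
      _ ≤ (1 - c a) * M + c a * M := by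
          gcongr
      _ = M := by ring

/-- Shrinking the coefficients of a sum costs at most a factor `2` over its subsums: the ratios are
split into positive and negative parts. -/
theorem seminorm_sum_smul_le_of_abs_le (p : Seminorm ℝ E) (e : ℕ → E) (F : Finset ℕ) (M : ℝ)
    (c d : ℕ → ℝ) (hcd : ∀ k ∈ F, |c k| ≤ |d k|)
    (h : ∀ G ⊆ F, p (∑ k ∈ G, d k • e k) ≤ M) : p (∑ k ∈ F, c k • e k) ≤ 2 * M := by
  set l : ℕ → ℝ := fun k => c k / d k with hl
  have hl1 : ∀ k ∈ F, |l k| ≤ 1 := fun k hk => by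
    rw [hl, abs_div]
    exact div_le_one_of_le₀ (hcd k hk) (abs_nonneg _)
  have hlc : ∀ k ∈ F, c k = l k * d k := fun k hk => by
    by_cases hd : d k = 0
    · have := hcd k hk
      rw [hd, abs_zero] at this
      simp [hd, abs_nonpos_iff.1 this]
    · simp [hl, hd]
  have hpart : ∀ m : ℕ → ℝ, (∀ k ∈ F, m k ∈ Icc (0 : ℝ) 1) →
      p (∑ k ∈ F, m k • d k • e k) ≤ M := fun m hm => by
    have := seminorm_add_sum_smul_le p (fun k => d k • e k) M m F hm 0 (by simpa using h)
    simpa using this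
  have hpos := hpart (fun k => max (l k) 0) fun k hk =>
    ⟨le_max_right _ _, max_le ((le_abs_self _).trans (hl1 k hk)) zero_le_one⟩
  have hneg := hpart (fun k => max (-l k) 0) fun k hk =>
    ⟨le_max_right _ _, max_le ((neg_le_abs _).trans (hl1 k hk)) zero_le_one⟩
  have heq : ∑ k ∈ F, c k • e k =
      ∑ k ∈ F, max (l k) 0 • d k • e k - ∑ k ∈ F, max (-l k) 0 • d k • e k := by
    rw [← Finset.sum_sub_distrib]
    refine Finset.sum_congr rfl fun k hk => ?_
    have : l k = max (l k) 0 - max (-l k) 0 := by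
      rcases le_total (l k) 0 with h | h <;> simp [h]
    rw [← sub_smul, ← this, smul_smul, ← hlc k hk]
  rw [heq]
  refine (map_sub_le_add _ _ _).trans ?_
  linarith

end Multipliers

namespace IsSchauderBasis

section Unconditional

variable {E : Type*} [AddCommGroup E] [Module ℝ E] [UniformSpace E] [IsUniformAddGroup E]
  [CompleteSpace E] {e : ℕ → E} {he : IsSchauderBasis e}

theorem IsUnconditional.summable (hunc : he.IsUnconditional) (x : E) :
    Summable fun k => he.coord k x • e k :=
  summable_of_forall_perm _ fun π => ⟨x, hunc x π⟩

variable [ContinuousSMul ℝ E]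

theorem IsUnconditional.exists_tail (hunc : he.IsUnconditional) {p : Seminorm ℝ E}
    (hp : Continuous p) (x : E) {ε : ℝ} (hε : 0 < ε) :
    ∃ N : ℕ, ∀ G : Finset ℕ, Disjoint G (Finset.range N) → p (he.proj G x) < ε := by
  have hU : {z : E | p z < ε} ∈ 𝓝 (0 : E) :=
    (isOpen_lt hp continuous_const).mem_nhds (by simpa using hε)
  obtain ⟨F, hF⟩ := summable_iff_vanishing.1 (hunc.summable x) _ hU
  refine ⟨F.sup id + 1, fun G hG => ?_⟩
  rw [proj_apply]
  refine hF G (hG.mono_right fun k hk => ?_)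
  exact Finset.mem_range.2 (Nat.lt_succ_of_le (Finset.le_sup (f := id) hk))

theorem IsUnconditional.bddAbove_range_proj (hunc : he.IsUnconditional) {p : Seminorm ℝ E}
    (hp : Continuous p) : BddAbove (range fun F : Finset ℕ => p.comp (he.proj F)) := by
  classical
  rw [Seminorm.bddAbove_range_iff]
  intro x
  obtain ⟨N, hN⟩ := hunc.exists_tail hp x one_pos
  refine ⟨∑ k ∈ Finset.range N, p (he.coord k x • e k) + 1, ?_⟩
  rintro _ ⟨F, rfl⟩
  have h1 : he.proj F x = he.proj (F ∩ Finset.range N) x + he.proj (F \ Finset.range N) x := by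
    simp only [proj_apply]
    exact (Finset.sum_inter_add_sum_sdiff _ _ _).symm
  have h2 : p (he.proj (F ∩ Finset.range N) x) ≤
      ∑ k ∈ Finset.range N, p (he.coord k x • e k) := by
    rw [proj_apply]
    exact (Finset.le_sum_of_subadditive p (map_zero p).le (map_add_le_add p) _ _).trans
      (Finset.sum_le_sum_of_subset_of_nonneg
      Finset.inter_subset_right fun _ _ _ => apply_nonneg _ _)
  have h3 := hN (F \ Finset.range N) Finset.sdiff_disjoint
  change p (he.proj F x) ≤ _
  rw [h1]
  exact (map_add_le_add _ _ _).trans (add_le_add h2 h3.le)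

/-- The unconditional majorant `x ↦ sup_F p (∑ k ∈ F, xₖ eₖ)` of a seminorm `p`, with `F` ranging
over the finite sets of indices. -/
def uncSeminorm (he : IsSchauderBasis e) (p : Seminorm ℝ E) : Seminorm ℝ E :=
  ⨆ F : Finset ℕ, p.comp (he.proj F)

theorem IsUnconditional.proj_le_uncSeminorm (hunc : he.IsUnconditional) {p : Seminorm ℝ E}
    (hp : Continuous p) (F : Finset ℕ) (x : E) : p (he.proj F x) ≤ he.uncSeminorm p x :=
  le_ciSup (hunc.bddAbove_range_proj hp) F x

theorem IsUnconditional.uncSeminorm_le (hunc : he.IsUnconditional) {p : Seminorm ℝ E}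
    (hp : Continuous p) {x : E} {M : ℝ} (h : ∀ F, p (he.proj F x) ≤ M) :
    he.uncSeminorm p x ≤ M := by
  rw [uncSeminorm, Seminorm.iSup_apply (hunc.bddAbove_range_proj hp)]
  exact ciSup_le h

theorem IsUnconditional.le_uncSeminorm (hunc : he.IsUnconditional) {p : Seminorm ℝ E}
    (hp : Continuous p) : p ≤ he.uncSeminorm p := fun x =>
  he.seminorm_le_of_proj_range_le hp fun _ => hunc.proj_le_uncSeminorm hp _ x

theorem IsUnconditional.uncSeminorm_mono (hunc : he.IsUnconditional) {p q : Seminorm ℝ E}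
    (hp : Continuous p) (hq : Continuous q) (hpq : p ≤ q) :
    he.uncSeminorm p ≤ he.uncSeminorm q := fun x =>
  hunc.uncSeminorm_le hp fun F => (hpq _).trans (hunc.proj_le_uncSeminorm hq F x)

/-- `E` is complete for the unconditional majorants of a defining sequence of seminorms: a Cauchy
sequence converges uniformly in `F` after projection to the coordinates in `F`. -/
theorem IsUnconditional.complete_uncSeminorm [T2Space E] (hunc : he.IsUnconditional)
    {p : ℕ → Seminorm ℝ E}
    (hp : WithSeminorms (p : SeminormFamily ℝ E ℕ)) (x : ℕ → E)
    (hx : ∀ s, ∀ ε : ℝ, 0 < ε → ∃ N, ∀ m, N ≤ m → ∀ n, N ≤ n →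
      he.uncSeminorm (p s) (x m - x n) ≤ ε) :
    ∃ y, ∀ s, ∀ ε : ℝ, 0 < ε → ∃ N, ∀ n, N ≤ n → he.uncSeminorm (p s) (x n - y) ≤ ε := by
  have hpc : ∀ s, Continuous (p s) := hp.continuous_seminorm
  have := isCountablyGenerated_uniformity hp
  have hcoord : ∀ k, ∃ c : ℝ, Tendsto (fun n => he.coord k (x n)) atTop (𝓝 c) := by
    intro k
    obtain ⟨s, hs⟩ := hp.separating_of_T1 (e k) (he.basis_ne_zero k)
    have hs' : 0 < p s (e k) := lt_of_le_of_ne (apply_nonneg _ _) (Ne.symm hs)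
    refine cauchySeq_tendsto_of_complete (Metric.cauchySeq_iff.2 fun ε hε => ?_)
    obtain ⟨N, hN⟩ := hx s (ε / 2 * p s (e k)) (by positivity)
    refine ⟨N, fun m hm n hn => ?_⟩
    have h1 := (hunc.proj_le_uncSeminorm (hpc s) {k} (x m - x n)).trans (hN m hm n hn)
    rw [proj_apply, Finset.sum_singleton, map_smul_eq_mul, coord_sub] at h1
    have h2 := le_of_mul_le_mul_right h1 hs'
    rw [Real.dist_eq, ← Real.norm_eq_abs]
    linarith
  choose c hc using hcoord
  have hlim : ∀ s, ∀ ε : ℝ, 0 < ε → ∃ N, ∀ n, N ≤ n → ∀ F : Finset ℕ,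
      p s (he.proj F (x n) - ∑ k ∈ F, c k • e k) ≤ ε := by
    intro s ε hε
    obtain ⟨N, hN⟩ := hx s ε hε
    refine ⟨N, fun n hn F => ?_⟩
    have h1 : Tendsto (fun m => p s (he.proj F (x n) - he.proj F (x m))) atTop
        (𝓝 (p s (he.proj F (x n) - ∑ k ∈ F, c k • e k))) := by
      refine ((hpc s).tendsto _).comp (tendsto_const_nhds.sub ?_)
      simp only [proj_apply]
      exact tendsto_finsetSum _ fun k _ => (hc k).smul_const _
    refine le_of_tendsto h1 ?_
    filter_upwards [eventually_ge_atTop N] with m hm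
    rw [← map_sub]
    exact (hunc.proj_le_uncSeminorm (hpc s) F _).trans (hN n hn m hm)
  have hcauchy : CauchySeq x := by
    rw [cauchySeq_iff_tendsto, uniformity_eq_comap_nhds_zero, tendsto_comap_iff, hp.tendsto_nhds]
    intro s ε hε
    obtain ⟨N, hN⟩ := hx s (ε / 2) (by positivity)
    filter_upwards [eventually_ge_atTop (N, N)] with mn hmn
    have := ((hunc.le_uncSeminorm (hpc s)) _).trans (hN mn.2 hmn.2 mn.1 hmn.1)
    simp only [Function.comp_apply, Prod.map, sub_zero]
    linarith
  obtain ⟨y, hy⟩ := cauchySeq_tendsto_of_complete hcauchy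
  have hexp : HasExpansion e c y := by
    rw [HasExpansion, hp.tendsto_nhds]
    intro s ε hε
    obtain ⟨N, hN⟩ := hlim s (ε / 4) (by positivity)
    obtain ⟨n, hn1, hn2⟩ := ((eventually_ge_atTop N).and
      ((hp.tendsto_nhds x y).1 hy s (ε / 4) (by positivity))).exists
    filter_upwards [(hp.tendsto_nhds _ _).1 (he.hasExpansion_coord (x n)) s (ε / 4)
      (by positivity)] with M hM
    have h1 := hN n hn1 (Finset.range M)
    rw [proj_apply] at h1
    have h2 : ∑ k ∈ Finset.range M, c k • e k - y =
        (∑ k ∈ Finset.range M, he.coord k (x n) • e k - x n) -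
        (∑ k ∈ Finset.range M, he.coord k (x n) • e k - ∑ k ∈ Finset.range M, c k • e k) +
        (x n - y) := by abel
    rw [h2]
    have h3 := map_add_le_add (p s) ((∑ k ∈ Finset.range M, he.coord k (x n) • e k - x n) -
        (∑ k ∈ Finset.range M, he.coord k (x n) • e k - ∑ k ∈ Finset.range M, c k • e k)) (x n - y)
    have h4 := map_sub_le_add (p s) (∑ k ∈ Finset.range M, he.coord k (x n) • e k - x n)
        (∑ k ∈ Finset.range M, he.coord k (x n) • e k - ∑ k ∈ Finset.range M, c k • e k)
    linarith
  refine ⟨y, fun s ε hε => ?_⟩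
  obtain ⟨N, hN⟩ := hlim s ε hε
  refine ⟨N, fun n hn => hunc.uncSeminorm_le (hpc s) fun F => ?_⟩
  have h1 := hN n hn F
  rw [map_sub, he.proj_apply F y]
  simpa only [hexp.coord_eq he] using h1

theorem IsUnconditional.continuous_uncSeminorm [T2Space E] (hunc : he.IsUnconditional)
    {p : ℕ → Seminorm ℝ E} (hp : WithSeminorms (p : SeminormFamily ℝ E ℕ)) (s : ℕ) :
    Continuous (he.uncSeminorm (p s)) := by
  have hP := hp.partial_sups
  have hPc : ∀ n, Continuous ((Finset.Iic n).sup p : Seminorm ℝ E) := hP.continuous_seminorm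
  have h1 := continuous_of_complete_finer (q := fun n => he.uncSeminorm ((Finset.Iic n).sup p)) hP
    (fun m n hmn => hunc.uncSeminorm_mono (hPc m) (hPc n)
      (Finset.sup_mono (Finset.Iic_subset_Iic.2 hmn)))
    (fun n => hunc.le_uncSeminorm (hPc n)) (hunc.complete_uncSeminorm hP) s
  exact Seminorm.continuous_of_le h1 (hunc.uncSeminorm_mono (hp.continuous_seminorm s) (hPc s)
    (Finset.le_sup (f := p) (Finset.mem_Iic.2 le_rfl)))

/-- The coordinate functionals of an unconditional basis are continuous; this is not part of the
definition of a Schauder basis. -/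
theorem IsUnconditional.continuous_coord [T2Space E] (hunc : he.IsUnconditional)
    {p : ℕ → Seminorm ℝ E}
    (hp : WithSeminorms (p : SeminormFamily ℝ E ℕ)) (k : ℕ) : Continuous (he.coord k) := by
  obtain ⟨s, hs⟩ := hp.separating_of_T1 (e k) (he.basis_ne_zero k)
  have hs' : 0 < p s (e k) := lt_of_le_of_ne (apply_nonneg _ _) (Ne.symm hs)
  have hq := hunc.continuous_uncSeminorm hp s
  have hbound : ∀ x, |he.coord k x| ≤ he.uncSeminorm (p s) x / p s (e k) := fun x => by
    have h1 := hunc.proj_le_uncSeminorm (hp.continuous_seminorm s) {k} x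
    rw [proj_apply, Finset.sum_singleton, map_smul_eq_mul, Real.norm_eq_abs] at h1
    rwa [le_div_iff₀ hs']
  refine continuous_of_continuousAt_zero (he.coordLM k) ?_
  rw [ContinuousAt, map_zero, tendsto_zero_iff_abs_tendsto_zero]
  refine squeeze_zero (fun _ => abs_nonneg _) hbound ?_
  simpa using (hq.tendsto 0).div_const (p s (e k))

/-- Any sequence dominated by the coordinates of an element is itself the coordinate sequence of an
element. -/
theorem IsUnconditional.exists_coord_eq (hunc : he.IsUnconditional) {p : ℕ → Seminorm ℝ E}
    (hp : WithSeminorms (p : SeminormFamily ℝ E ℕ)) (x : E) {c : ℕ → ℝ}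
    (hc : ∀ k, |c k| ≤ |he.coord k x|) : ∃ y, ∀ k, he.coord k y = c k := by
  have hsum : Summable fun k => c k • e k := by
    refine summable_iff_vanishing.2 fun U hU => ?_
    obtain ⟨s, ε, hε, hsub⟩ := (hp.mem_nhds_iff 0 U).1 hU
    have hcont : Continuous (s.sup p : Seminorm ℝ E) := Seminorm.continuous_finsetSup fun i _ =>
      hp.continuous_seminorm i
    obtain ⟨N, hN⟩ := hunc.exists_tail hcont x (show 0 < ε / 4 by positivity)
    refine ⟨Finset.range N, fun F hF => hsub ?_⟩
    rw [Seminorm.mem_ball_zero]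
    have := seminorm_sum_smul_le_of_abs_le (s.sup p) e F (ε / 4) c (fun k => he.coord k x)
      (fun k _ => hc k) fun G hG => by
        simpa only [proj_apply] using (hN G (hF.mono_left hG)).le
    linarith
  obtain ⟨y, hy⟩ := hsum
  exact ⟨y, HasExpansion.coord_eq hy.tendsto_sum_nat he⟩

/-- An element lying coordinatewise above `a` and below `b` exists for any choice of the
coordinates. -/
theorem IsUnconditional.exists_coord_eq_of_le_of_le (hunc : he.IsUnconditional)
    (hp : WithSeminorms (p : SeminormFamily ℝ E ℕ)) {a b : E} {c : ℕ → ℝ}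
    (hac : ∀ k, he.coord k a ≤ c k) (hcb : ∀ k, c k ≤ he.coord k b) :
    ∃ y, ∀ k, he.coord k y = c k := by
  obtain ⟨y, hy⟩ := hunc.exists_coord_eq hp (b - a) (c := fun k => c k - he.coord k a) fun k => by
    rw [he.coord_sub, abs_of_nonneg (sub_nonneg.2 (hac k))]
    exact (sub_le_sub_right (hcb k) _).trans (le_abs_self _)
  exact ⟨a + y, fun k => by rw [he.coord_add, hy]; ring⟩

theorem IsUnconditional.exists_coord_eq_max (hunc : he.IsUnconditional)
    (hp : WithSeminorms (p : SeminormFamily ℝ E ℕ)) (a b : E) :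
    ∃ y, ∀ k, he.coord k y = max (he.coord k a) (he.coord k b) := by
  obtain ⟨y, hy⟩ := hunc.exists_coord_eq hp (b - a)
    (c := fun k => max (he.coord k a) (he.coord k b) - he.coord k a) fun k => by
      rw [he.coord_sub]
      rcases le_total (he.coord k a) (he.coord k b) with h | h <;> simp [h]
  exact ⟨a + y, fun k => by rw [he.coord_add, hy]; ring⟩

/-- The expansions converge uniformly over all `y` dominated coordinatewise by a fixed `x`. -/
theorem IsUnconditional.exists_seminorm_sub_proj_le (hunc : he.IsUnconditional)
    {p : Seminorm ℝ E} (hp : Continuous p) (x : E) {ε : ℝ} (hε : 0 < ε) :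
    ∃ N, ∀ n, N ≤ n → ∀ y, (∀ k, |he.coord k y| ≤ |he.coord k x|) →
      p (y - he.proj (Finset.range n) y) ≤ ε := by
  classical
  obtain ⟨N, hN⟩ := hunc.exists_tail hp x (show 0 < ε / 2 by positivity)
  refine ⟨N, fun n hn y hy => ?_⟩
  have hlim : Tendsto (fun m => p (he.proj (Finset.range m) y - he.proj (Finset.range n) y)) atTop
      (𝓝 (p (y - he.proj (Finset.range n) y))) := by
    refine (hp.tendsto _).comp (Tendsto.sub ?_ tendsto_const_nhds)
    simp only [proj_apply]
    exact he.hasExpansion_coord y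
  refine le_of_tendsto hlim ?_
  filter_upwards [eventually_ge_atTop n] with m hm
  have hsub : Finset.range n ⊆ Finset.range m := Finset.range_subset_range.2 hm
  have h1 : he.proj (Finset.range m) y - he.proj (Finset.range n) y =
      ∑ k ∈ Finset.range m \ Finset.range n, he.coord k y • e k := by
    rw [proj_apply, proj_apply, ← Finset.sum_sdiff hsub, add_sub_cancel_right]
  rw [h1]
  have := seminorm_sum_smul_le_of_abs_le p e (Finset.range m \ Finset.range n) (ε / 2)
    (fun k => he.coord k y) (fun k => he.coord k x) (fun k _ => hy k) fun G hG => by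
      have hd : Disjoint G (Finset.range N) := (Finset.sdiff_disjoint.mono_left hG).mono_right
        (Finset.range_subset_range.2 hn)
      simpa only [proj_apply] using (hN G hd).le
  linarith

theorem IsUnconditional.uncSeminorm_le_of_abs_coord_le (hunc : he.IsUnconditional)
    {p : Seminorm ℝ E} (hp : Continuous p) {x y : E}
    (h : ∀ k, |he.coord k y| ≤ |he.coord k x|) :
    he.uncSeminorm p y ≤ 2 * he.uncSeminorm p x := by
  refine hunc.uncSeminorm_le hp fun F => ?_
  rw [proj_apply]
  refine seminorm_sum_smul_le_of_abs_le p e _ _ _ (fun k => he.coord k x) (fun k _ => h k) ?_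
  intro G _
  simpa only [proj_apply] using hunc.proj_le_uncSeminorm hp G x

/-- On an order interval, coordinatewise convergence is convergence. -/
theorem IsUnconditional.tendsto_of_tendsto_coord (hunc : he.IsUnconditional)
    {p : ℕ → Seminorm ℝ E} (hp : WithSeminorms (p : SeminormFamily ℝ E ℕ)) {ι : Type*}
    {l : Filter ι} {a b y : E} {u : ι → E} (hau : ∀ᶠ i in l, he.le a (u i))
    (hub : ∀ᶠ i in l, he.le (u i) b) (hay : he.le a y) (hyb : he.le y b)
    (hlim : ∀ k, Tendsto (fun i => he.coord k (u i)) l (𝓝 (he.coord k y))) :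
    Tendsto u l (𝓝 y) := by
  rw [hp.tendsto_nhds]
  intro s ε hε
  have hpc := hp.continuous_seminorm s
  obtain ⟨N, hN⟩ := hunc.exists_seminorm_sub_proj_le hpc (b - a) (show 0 < ε / 2 by positivity)
  have hfin : Tendsto (fun i => p s (he.proj (Finset.range N) (u i - y))) l (𝓝 0) := by
    have h1 : Tendsto (fun i => he.proj (Finset.range N) (u i - y)) l (𝓝 0) := by
      simp only [proj_apply, coord_sub]
      have h2 : Tendsto (fun i => ∑ k ∈ Finset.range N, (he.coord k (u i) - he.coord k y) • e k) l
          (𝓝 (∑ k ∈ Finset.range N, (he.coord k y - he.coord k y) • e k)) :=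
        tendsto_finsetSum _ fun k _ => ((hlim k).sub_const _).smul_const _
      simpa using h2
    have h3 := (hpc.tendsto 0).comp h1
    rwa [map_zero] at h3
  filter_upwards [hau, hub, hfin.eventually_lt_const (show 0 < ε / 2 by positivity)]
    with i h1 h2 h3
  have h4 := hN N le_rfl (u i - y) fun k => by
    have := h1 k
    have := h2 k
    have := hay k
    have := hyb k
    rw [coord_sub, coord_sub]
    exact (abs_le.2 ⟨by linarith, by linarith⟩).trans (le_abs_self _)
  have h5 := map_add_le_add (p s) (u i - y - he.proj (Finset.range N) (u i - y))
    (he.proj (Finset.range N) (u i - y))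
  rw [sub_add_cancel] at h5
  linarith

end Unconditional

end IsSchauderBasis

/-! ### The integral of functions with values in a Fréchet space -/

section StepIntegral

variable {E : Type*} [AddCommGroup E] [Module ℝ E] {α : Type*} [MeasurableSpace α]
  {μ : Measure α} [IsFiniteMeasure μ]

theorem stepIntegral_map {β : Type*} (H : SimpleFunc α β) (φ : β → E) :
    stepIntegral μ (H.map φ) = ∑ x ∈ H.range, μ.real (H ⁻¹' {x}) • φ x := by
  classical
  simp only [stepIntegral, SimpleFunc.range_map]
  refine Finset.sum_image' _ fun b hb => ?_
  rcases SimpleFunc.mem_range.1 hb with ⟨a, rfl⟩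
  have h1 : μ.real (H.map φ ⁻¹' {φ (H a)}) =
      ∑ y ∈ H.range with φ y = φ (H a), μ.real (H ⁻¹' {y}) := by
    rw [SimpleFunc.map_preimage_singleton]
    simp only [Measure.real]
    rw [← H.sum_measure_preimage_singleton, ENNReal.toReal_sum fun _ _ => measure_ne_top _ _]
  rw [h1, Finset.sum_smul]
  refine Finset.sum_congr rfl fun y hy => ?_
  rw [(Finset.mem_filter.1 hy).2]

/-- The integral of step functions is a contraction for the mean seminorms; both functions are
written as images of their pairing, so that they share one partition. -/
theorem ofReal_seminorm_stepIntegral_sub_le (p : Seminorm ℝ E) (F G : SimpleFunc α E) :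
    ENNReal.ofReal (p (stepIntegral μ F - stepIntegral μ G)) ≤
      ∫⁻ t, ENNReal.ofReal (p (F t - G t)) ∂μ := by
  have hF : F = (F.pair G).map Prod.fst := by ext; rfl
  have hG : G = (F.pair G).map Prod.snd := by ext; rfl
  have hint : ∫⁻ t, ENNReal.ofReal (p (F t - G t)) ∂μ =
      ∑ x ∈ (F.pair G).range, ENNReal.ofReal (p (x.1 - x.2)) * μ (F.pair G ⁻¹' {x}) := by
    rw [← SimpleFunc.map_lintegral (fun x : E × E => ENNReal.ofReal (p (x.1 - x.2))),
      ← SimpleFunc.lintegral_eq_lintegral]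
    rfl
  have hsub : stepIntegral μ F - stepIntegral μ G =
      ∑ x ∈ (F.pair G).range, μ.real (F.pair G ⁻¹' {x}) • (x.1 - x.2) := by
    have h1 := stepIntegral_map (μ := μ) (F.pair G) (Prod.fst : E × E → E)
    have h2 := stepIntegral_map (μ := μ) (F.pair G) (Prod.snd : E × E → E)
    rw [← hF] at h1
    rw [← hG] at h2
    rw [h1, h2, ← Finset.sum_sub_distrib]
    simp only [smul_sub]
  rw [hint, hsub]
  calc ENNReal.ofReal (p (∑ x ∈ (F.pair G).range, μ.real (F.pair G ⁻¹' {x}) • (x.1 - x.2)))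
      ≤ ENNReal.ofReal (∑ x ∈ (F.pair G).range, μ.real (F.pair G ⁻¹' {x}) * p (x.1 - x.2)) := by
        refine ENNReal.ofReal_le_ofReal ((Finset.le_sum_of_subadditive p (map_zero p).le
          (map_add_le_add p) _ _).trans_eq (Finset.sum_congr rfl fun x _ => ?_))
        rw [map_smul_eq_mul, Real.norm_of_nonneg measureReal_nonneg]
    _ = _ := by
        rw [ENNReal.ofReal_sum_of_nonneg fun _ _ => mul_nonneg measureReal_nonneg
          (apply_nonneg _ _)]
        refine Finset.sum_congr rfl fun x _ => ?_
        rw [ENNReal.ofReal_mul measureReal_nonneg, ofReal_measureReal, mul_comm]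

variable [TopologicalSpace E]

theorem integral_comp_simpleFunc (φ : E →L[ℝ] ℝ) (H : SimpleFunc α E) :
    ∫ t, φ (H t) ∂μ = φ (stepIntegral μ H) := by
  have h1 : ∫ t, φ (H t) ∂μ = (H.map φ).integral μ := by
    rw [SimpleFunc.integral_eq_integral _ (SimpleFunc.integrable_of_isFiniteMeasure _)]
    rfl
  have h2 : (H.map φ).integral μ = stepIntegral μ (H.map φ) := by
    rw [SimpleFunc.integral_def, SimpleFunc.setToSimpleFunc]
    simp [stepIntegral, weightedSMul]
  rw [h1, h2, stepIntegral_map, stepIntegral, map_sum]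
  simp only [map_smul]

/-- A function that can be approximated by step functions in the mean with respect to each
seminorm is integrable: approximations with summable errors converge almost everywhere. -/
theorem fIntegrable_of_forall_exists_lintegral_le {p : ℕ → Seminorm ℝ E} {g : α → E}
    (hp : WithSeminorms (p : SeminormFamily ℝ E ℕ))
    (h : ∀ n : ℕ, ∀ ε : ℝ, 0 < ε → ∃ G : SimpleFunc α E,
      AEMeasurable (fun t => ((Finset.Iic n).sup p : Seminorm ℝ E) (g t - G t)) μ ∧
      ∫⁻ t, ENNReal.ofReal (((Finset.Iic n).sup p : Seminorm ℝ E) (g t - G t)) ∂μ ≤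
        ENNReal.ofReal ε) :
    FIntegrable p μ g := by
  choose G hGm hG using fun n : ℕ => h n ((1 / 2) ^ n) (by positivity)
  set P : ℕ → Seminorm ℝ E := fun n => (Finset.Iic n).sup p with hP
  have hpP : ∀ s n, s ≤ n → p s ≤ P n := fun s n hsn =>
    Finset.le_sup (f := p) (Finset.mem_Iic.2 hsn)
  have hsum : Summable fun n : ℕ => ((1 : ℝ) / 2) ^ n := summable_geometric_two
  refine ⟨G, fun n => ?_, fun s ε hε => ?_, ?_⟩
  · rw [SimpleFunc.finMeasSupp_iff]
    exact fun y _ => measure_lt_top _ _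
  · obtain ⟨l, hl⟩ := eventually_atTop.1
      (hsum.tendsto_atTop_zero.eventually_lt_const (show 0 < ε / 2 by positivity))
    refine ⟨max l s, fun i m hi hm => ?_⟩
    have h1 := hl i (by omega)
    have h2 := hl m (by omega)
    calc ∫⁻ t, ENNReal.ofReal (p s (G i t - G m t)) ∂μ
        ≤ ∫⁻ t, (ENNReal.ofReal (P i (g t - G i t)) + ENNReal.ofReal (P m (g t - G m t))) ∂μ := by
          refine lintegral_mono fun t => ?_
          rw [← ENNReal.ofReal_add (apply_nonneg _ _) (apply_nonneg _ _)]
          refine ENNReal.ofReal_le_ofReal ?_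
          have h3 := map_sub_le_add (p s) (g t - G m t) (g t - G i t)
          rw [sub_sub_sub_cancel_left] at h3
          have h4 := hpP s i (by omega) (g t - G i t)
          have h5 := hpP s m (by omega) (g t - G m t)
          linarith
      _ = ∫⁻ t, ENNReal.ofReal (P i (g t - G i t)) ∂μ +
            ∫⁻ t, ENNReal.ofReal (P m (g t - G m t)) ∂μ :=
          lintegral_add_left' (hGm i).ennreal_ofReal _
      _ ≤ ENNReal.ofReal ((1 / 2) ^ i) + ENNReal.ofReal ((1 / 2) ^ m) := add_le_add (hG i) (hG m)
      _ < ENNReal.ofReal ε := by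
          rw [← ENNReal.ofReal_add (by positivity) (by positivity)]
          exact (ENNReal.ofReal_lt_ofReal_iff hε).2 (by linarith)
  · have hfin : ∫⁻ t, ∑' n, ENNReal.ofReal (P n (g t - G n t)) ∂μ ≠ ⊤ := by
      rw [lintegral_tsum fun n => (hGm n).ennreal_ofReal]
      refine ne_top_of_le_ne_top ?_ (ENNReal.tsum_le_tsum hG)
      rw [← ENNReal.ofReal_tsum_of_nonneg (fun n => by positivity) hsum]
      exact ENNReal.ofReal_ne_top
    filter_upwards [ae_lt_top' (AEMeasurable.tsum fun n => (hGm n).ennreal_ofReal) hfin]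
      with t ht
    rw [hp.tendsto_nhds]
    intro s ε hε
    have h1 := ENNReal.tendsto_atTop_zero_of_tsum_ne_top ht.ne
    filter_upwards [h1.eventually_lt_const (ENNReal.ofReal_pos.2 hε), eventually_ge_atTop s]
      with n hn hsn
    have h2 := (ENNReal.ofReal_lt_ofReal_iff hε).1 hn
    rw [map_sub_rev]
    exact (hpP s n hsn _).trans_lt h2

end StepIntegral

section Integral

variable {E : Type*} [AddCommGroup E] [Module ℝ E] [UniformSpace E]
  {α : Type*} [MeasurableSpace α] {μ : Measure α}
  {p : ℕ → Seminorm ℝ E} {g : α → E} {F : ℕ → SimpleFunc α E}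

theorem FIntegrable.mono_measure {E : Type*} [AddCommGroup E] [Module ℝ E] [TopologicalSpace E]
    {p : ℕ → Seminorm ℝ E} {g : α → E} {ν : Measure α} (hνμ : ν ≤ μ)
    (hg : FIntegrable p μ g) : FIntegrable p ν g := by
  obtain ⟨F, h1, h2, h3⟩ := hg
  refine ⟨F, fun n => ?_, fun s ε hε => ?_, (Measure.absolutelyContinuous_of_le hνμ).ae_le h3⟩
  · rw [SimpleFunc.finMeasSupp_iff]
    exact fun y hy => (hνμ _).trans_lt (SimpleFunc.finMeasSupp_iff.1 (h1 n) y hy)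
  · obtain ⟨l, hl⟩ := h2 s ε hε
    exact ⟨l, fun i m hi hm => (lintegral_mono' hνμ le_rfl).trans_lt (hl i m hi hm)⟩

/-- The Cauchy condition on an approximating sequence passes from the defining seminorms to all
continuous ones. -/
theorem IsApproximating.exists_lintegral_seminorm_le (hp : WithSeminorms (p : SeminormFamily ℝ E ℕ))
    (hF : IsApproximating p μ F g) {r : Seminorm ℝ E} (hr : Continuous r) {ε : ℝ} (hε : 0 < ε) :
    ∃ l : ℕ, ∀ i m : ℕ, l < i → l < m →
      ∫⁻ t, ENNReal.ofReal (r (F i t - F m t)) ∂μ ≤ ENNReal.ofReal ε := by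
  classical
  obtain ⟨S, C, -, hC⟩ := Seminorm.bound_of_continuous hp r hr
  have hδ : 0 < ε / (C * S.card + 1) := by positivity
  choose l hl using fun s => hF.2.1 s _ hδ
  refine ⟨S.sup l, fun i m hi hm => ?_⟩
  have hmeas : ∀ s, Measurable fun t => ENNReal.ofReal (p s (F i t - F m t)) := fun s =>
    ((F i - F m).map fun x => ENNReal.ofReal (p s x)).measurable
  have hle : ∀ x, ENNReal.ofReal (r x) ≤ C * ∑ s ∈ S, ENNReal.ofReal (p s x) := fun x => by
    have h1 : r x ≤ C * ∑ s ∈ S, p s x := by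
      refine (hC x).trans ?_
      rw [smul_apply, NNReal.smul_def, smul_eq_mul]
      gcongr
      simpa using (Seminorm.finset_sup_le_sum p S) x
    refine (ENNReal.ofReal_le_ofReal h1).trans_eq ?_
    rw [ENNReal.ofReal_mul C.coe_nonneg, ENNReal.ofReal_sum_of_nonneg fun _ _ => apply_nonneg _ _,
      ENNReal.ofReal_coe_nnreal]
  calc ∫⁻ t, ENNReal.ofReal (r (F i t - F m t)) ∂μ
      ≤ ∫⁻ t, C * ∑ s ∈ S, ENNReal.ofReal (p s (F i t - F m t)) ∂μ :=
        lintegral_mono fun t => hle _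
    _ = C * ∑ s ∈ S, ∫⁻ t, ENNReal.ofReal (p s (F i t - F m t)) ∂μ := by
        rw [lintegral_const_mul _ (Finset.measurable_sum _ fun s _ => hmeas s),
          lintegral_finsetSum _ fun s _ => hmeas s]
    _ ≤ C * ∑ s ∈ S, ENNReal.ofReal (ε / (C * S.card + 1)) := by
        gcongr with s hs
        exact (hl s i m ((Finset.le_sup hs).trans_lt hi) ((Finset.le_sup hs).trans_lt hm)).le
    _ = ENNReal.ofReal (C * (S.card * (ε / (C * S.card + 1)))) := by
        rw [Finset.sum_const, nsmul_eq_mul, ENNReal.ofReal_mul C.coe_nonneg,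
          ENNReal.ofReal_coe_nnreal, ENNReal.ofReal_mul (Nat.cast_nonneg _), ENNReal.ofReal_natCast]
    _ ≤ ENNReal.ofReal ε := by
        refine ENNReal.ofReal_le_ofReal ?_
        have : (C : ℝ) * (S.card * (ε / (C * S.card + 1))) =
            ε * (C * S.card) / (C * S.card + 1) := by ring
        rw [this, div_le_iff₀ (by positivity)]
        nlinarith

variable [IsUniformAddGroup E]

/-- An approximating sequence converges in the mean with respect to every continuous seminorm. -/
theorem IsApproximating.tendsto_lintegral_seminorm
    (hp : WithSeminorms (p : SeminormFamily ℝ E ℕ))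
    (hF : IsApproximating p μ F g) {r : Seminorm ℝ E} (hr : Continuous r) :
    Tendsto (fun n => ∫⁻ t, ENNReal.ofReal (r (F n t - g t)) ∂μ) atTop (𝓝 0) := by
  rw [ENNReal.tendsto_atTop_zero]
  intro ε hε
  obtain ⟨δ, hδ0, hδ⟩ : ∃ δ : ℝ, 0 < δ ∧ ENNReal.ofReal δ ≤ ε := by
    obtain ⟨δ, hδ0, hδ⟩ := ENNReal.lt_iff_exists_nnreal_btwn.1 hε
    exact ⟨δ, by exact_mod_cast hδ0, by simpa using hδ.le⟩
  obtain ⟨l, hl⟩ := hF.exists_lintegral_seminorm_le hp hr hδ0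
  refine ⟨l + 1, fun n hn => le_trans ?_ hδ⟩
  calc ∫⁻ t, ENNReal.ofReal (r (F n t - g t)) ∂μ
      ≤ ∫⁻ t, liminf (fun m => ENNReal.ofReal (r (F n t - F m t))) atTop ∂μ := by
        refine lintegral_mono_ae ?_
        filter_upwards [hF.2.2] with t ht
        refine (Tendsto.liminf_eq ?_).ge
        exact (ENNReal.continuous_ofReal.tendsto _).comp
          ((hr.tendsto _).comp (tendsto_const_nhds.sub ht))
    _ ≤ liminf (fun m => ∫⁻ t, ENNReal.ofReal (r (F n t - F m t)) ∂μ) atTop :=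
        lintegral_liminf_le fun m =>
          ((F n - F m).map fun x => ENNReal.ofReal (r x)).measurable
    _ ≤ ENNReal.ofReal δ := by
        refine liminf_le_of_frequently_le' (Eventually.frequently ?_)
        filter_upwards [eventually_gt_atTop l] with m hm
        exact hl n m (by omega) hm

variable [IsFiniteMeasure μ]

theorem FIntegrable.exists_hasFIntegral [CompleteSpace E]
    (hp : WithSeminorms (p : SeminormFamily ℝ E ℕ)) (hg : FIntegrable p μ g) :
    ∃ I, HasFIntegral p μ g I := by
  have := isCountablyGenerated_uniformity hp
  obtain ⟨F, hF⟩ := hg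
  have hcauchy : CauchySeq fun n => stepIntegral μ (F n) := by
    rw [cauchySeq_iff_tendsto, uniformity_eq_comap_nhds_zero, tendsto_comap_iff, hp.tendsto_nhds]
    intro s ε hε
    obtain ⟨l, hl⟩ := hF.2.1 s ε hε
    filter_upwards [eventually_ge_atTop (l + 1, l + 1)] with mn hmn
    have h1 := (ofReal_seminorm_stepIntegral_sub_le (p s) (F mn.2) (F mn.1)).trans_lt
      (hl mn.2 mn.1 hmn.2 hmn.1)
    simpa only [Function.comp_apply, Prod.map, sub_zero] using
      (ENNReal.ofReal_lt_ofReal_iff hε).1 h1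
  obtain ⟨I, hI⟩ := cauchySeq_tendsto_of_complete hcauchy
  exact ⟨I, F, hF, hI⟩

theorem FIntegrable.hasFIntegral_fIntegral [CompleteSpace E]
    (hp : WithSeminorms (p : SeminormFamily ℝ E ℕ)) (hg : FIntegrable p μ g) :
    HasFIntegral p μ g (fIntegral p μ g) := by
  have h := hg.exists_hasFIntegral hp
  rw [fIntegral, dif_pos h]
  exact h.choose_spec

/-- Continuous linear forms commute with the integral. -/
theorem HasFIntegral.integrable_and_integral_eq (hp : WithSeminorms (p : SeminormFamily ℝ E ℕ))
    {I : E} (hg : HasFIntegral p μ g I) (φ : E →L[ℝ] ℝ) :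
    Integrable (fun t => φ (g t)) μ ∧ ∫ t, φ (g t) ∂μ = φ I := by
  obtain ⟨F, hF, hI⟩ := hg
  set r : Seminorm ℝ E := (normSeminorm ℝ ℝ).comp (φ : E →ₗ[ℝ] ℝ) with hr
  have hrc : Continuous r := continuous_norm.comp φ.continuous
  have hlim : Tendsto (fun n => ∫⁻ t, ‖φ (F n t) - φ (g t)‖ₑ ∂μ) atTop (𝓝 0) := by
    refine (hF.tendsto_lintegral_seminorm hp hrc).congr fun n => lintegral_congr fun t => ?_
    rw [← ofReal_norm, ← map_sub]
    rfl
  have hint : ∀ n, Integrable (fun t => φ (F n t)) μ := fun n =>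
    SimpleFunc.integrable_of_isFiniteMeasure ((F n).map φ)
  have hmeas : AEStronglyMeasurable (fun t => φ (g t)) μ := by
    refine aestronglyMeasurable_of_tendsto_ae atTop (fun n => (hint n).aestronglyMeasurable) ?_
    filter_upwards [hF.2.2] with t ht
    exact (φ.continuous.tendsto _).comp ht
  constructor
  · obtain ⟨n, hn⟩ := (hlim.eventually_lt_const (show (0 : ENNReal) < 1 by simp)).exists
    have h1 : Integrable (fun t => φ (F n t) - φ (g t)) μ :=
      ⟨(hint n).aestronglyMeasurable.sub hmeas, hn.trans (by simp)⟩
    exact ((hint n).sub h1).congr (Eventually.of_forall fun t => by simp)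
  · refine tendsto_nhds_unique (tendsto_integral_of_L1 _ hmeas (Eventually.of_forall hint) hlim) ?_
    simp only [integral_comp_simpleFunc]
    exact (φ.continuous.tendsto _).comp hI

theorem FIntegrable.lintegral_seminorm_lt_top (hp : WithSeminorms (p : SeminormFamily ℝ E ℕ))
    (hg : FIntegrable p μ g) {r : Seminorm ℝ E} (hr : Continuous r) :
    ∫⁻ t, ENNReal.ofReal (r (g t)) ∂μ < ⊤ := by
  obtain ⟨F, hF⟩ := hg
  obtain ⟨n, hn⟩ := ((hF.tendsto_lintegral_seminorm hp hr).eventually_lt_const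
    (show (0 : ENNReal) < 1 by simp)).exists
  have hmeas : Measurable fun t => ENNReal.ofReal (r (F n t)) :=
    ((F n).map fun x => ENNReal.ofReal (r x)).measurable
  have hfin : ∫⁻ t, ENNReal.ofReal (r (F n t)) ∂μ < ⊤ := by
    have := (SimpleFunc.integrable_of_isFiniteMeasure (μ := μ) ((F n).map r)).lintegral_lt_top
    exact this
  calc ∫⁻ t, ENNReal.ofReal (r (g t)) ∂μ
      ≤ ∫⁻ t, (ENNReal.ofReal (r (F n t)) + ENNReal.ofReal (r (F n t - g t))) ∂μ := by
        refine lintegral_mono fun t => ?_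
        rw [← ENNReal.ofReal_add (apply_nonneg _ _) (apply_nonneg _ _)]
        refine ENNReal.ofReal_le_ofReal ?_
        have := map_sub_le_add r (F n t) (F n t - g t)
        rwa [sub_sub_cancel] at this
    _ = ∫⁻ t, ENNReal.ofReal (r (F n t)) ∂μ + ∫⁻ t, ENNReal.ofReal (r (F n t - g t)) ∂μ :=
        lintegral_add_left hmeas _
    _ < ⊤ := ENNReal.add_lt_top.2 ⟨hfin, hn.trans (by simp)⟩

end Integral

/-! ### Integrability of order-bounded functions -/

theorem aemeasurable_apply_of_countable {α ι : Type*} [MeasurableSpace α] {μ : Measure α}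
    [Countable ι] [MeasurableSpace ι] [MeasurableSingletonClass ι] {h : ι → α → ℝ}
    (hm : ∀ i, AEMeasurable (h i) μ) {z : α → ι} (hz : AEMeasurable z μ) :
    AEMeasurable (fun t => h (z t) t) μ := by
  choose H hHm hH using hm
  have hjoint : Measurable fun q : α × ι => H q.2 q.1 :=
    measurable_from_prod_countable_left hHm
  refine ⟨fun t => H (hz.mk z t) t, hjoint.comp (measurable_id.prodMk hz.measurable_mk), ?_⟩
  filter_upwards [ae_all_iff.2 hH, hz.ae_eq_mk] with t h1 h2
  rw [h1, ← h2]

theorem floor_div_two_pow_le_succ (x : ℝ) (n : ℕ) :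
    (⌊x * 2 ^ n⌋ : ℝ) / 2 ^ n ≤ (⌊x * 2 ^ (n + 1)⌋ : ℝ) / 2 ^ (n + 1) := by
  have h1 : 2 * ⌊x * 2 ^ n⌋ ≤ ⌊x * 2 ^ (n + 1)⌋ := by
    rw [Int.le_floor]
    push_cast
    have := Int.floor_le (x * 2 ^ n)
    rw [pow_succ]
    linarith
  have h2 : 2 * (⌊x * 2 ^ n⌋ : ℝ) ≤ (⌊x * 2 ^ (n + 1)⌋ : ℝ) := by exact_mod_cast h1
  have h3 : (0 : ℝ) < 2 ^ n := by positivity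
  rw [div_le_div_iff₀ (by positivity) (by positivity)]
  calc (⌊x * 2 ^ n⌋ : ℝ) * 2 ^ (n + 1) = 2 * ⌊x * 2 ^ n⌋ * 2 ^ n := by ring
    _ ≤ _ := by gcongr

theorem tendsto_floor_div_two_pow (x : ℝ) :
    Tendsto (fun n : ℕ => (⌊x * 2 ^ n⌋ : ℝ) / 2 ^ n) atTop (𝓝 x) := by
  have h1 : Tendsto (fun n : ℕ => x - (2⁻¹ : ℝ) ^ n) atTop (𝓝 (x - 0)) :=
    tendsto_const_nhds.sub
      (tendsto_pow_atTop_nhds_zero_of_lt_one (by norm_num) (by norm_num))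
  rw [sub_zero] at h1
  refine tendsto_of_tendsto_of_tendsto_of_le_of_le h1 tendsto_const_nhds (fun n => ?_) fun n => ?_
  · have h2 : (0 : ℝ) < 2 ^ n := by positivity
    have h3 := (Int.lt_floor_add_one (x * 2 ^ n)).le
    simp only [le_div_iff₀ h2, sub_mul, inv_pow, inv_mul_cancel₀ h2.ne']
    linarith
  · simp only [div_le_iff₀ (show (0 : ℝ) < 2 ^ n by positivity)]
    exact Int.floor_le _

namespace IsSchauderBasis

section OrderBounded

variable {E : Type*} [AddCommGroup E] [Module ℝ E] [UniformSpace E] [IsUniformAddGroup E]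
  [ContinuousSMul ℝ E] {e : ℕ → E} {he : IsSchauderBasis e}
  {α : Type*} [MeasurableSpace α] {μ : Measure α}

theorem coord_sub_proj (he : IsSchauderBasis e) (k : ℕ) (F : Finset ℕ) (x : E) :
    he.coord k (x - he.proj F x) = if k ∈ F then 0 else he.coord k x := by
  rw [coord_sub, proj_apply, coord_sum_smul_basis]
  split_ifs <;> simp

theorem aemeasurable_seminorm (he : IsSchauderBasis e) {r : Seminorm ℝ E} (hr : Continuous r)
    {h : α → E} (hm : ∀ k, AEMeasurable (fun t => he.coord k (h t)) μ) :
    AEMeasurable (fun t => r (h t)) μ := by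
  refine aemeasurable_of_tendsto_metrizable_ae atTop
    (f := fun n t => r (∑ k ∈ Finset.range n, he.coord k (h t) • e k)) (fun n => ?_)
    (Eventually.of_forall fun t => (hr.tendsto _).comp (he.hasExpansion_coord (h t)))
  have hc : Continuous fun v : ℕ → ℝ => r (∑ k ∈ Finset.range n, v k • e k) :=
    hr.comp (continuous_finsetSum _ fun k _ => (continuous_apply k).smul continuous_const)
  exact hc.measurable.comp_aemeasurable (aemeasurable_pi_lambda _ hm)

/-- A truncated expansion with integrable coordinates is approximated in the mean by step functions,
one coordinate at a time. -/
theorem exists_simpleFunc_lintegral_proj_le (he : IsSchauderBasis e) [IsFiniteMeasure μ]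
    (r : Seminorm ℝ E) {g : α → E}
    (hg : ∀ k, Integrable (fun t => he.coord k (g t)) μ) (N : ℕ) {ε : ℝ} (hε : 0 < ε) :
    ∃ G : SimpleFunc α E,
      ∫⁻ t, ENNReal.ofReal (r (he.proj (Finset.range N) (g t) - G t)) ∂μ ≤ ENNReal.ofReal ε := by
  induction N generalizing ε with
  | zero => exact ⟨0, by simp [proj_apply]⟩
  | succ N ih =>
    obtain ⟨G, hG⟩ := ih (half_pos hε)
    have hδ : 0 < ε / 2 / (r (e N) + 1) := by positivity
    obtain ⟨s, hs, hsm⟩ := (memLp_one_iff_integrable.2 (hg N)).exists_simpleFunc_eLpNorm_sub_lt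
      ENNReal.one_ne_top (ε := ENNReal.ofReal (ε / 2 / (r (e N) + 1)))
      (ENNReal.ofReal_pos.2 hδ).ne'
    rw [eLpNorm_one_eq_lintegral_enorm] at hs
    have hterm : ∀ t, ENNReal.ofReal (r (he.coord N (g t) • e N - s t • e N)) =
        ENNReal.ofReal (r (e N)) * ‖((fun t => he.coord N (g t)) - s) t‖ₑ := fun t => by
      rw [← sub_smul, map_smul_eq_mul, ENNReal.ofReal_mul (norm_nonneg _), ofReal_norm, mul_comm]
      rfl
    have hmeas : AEMeasurable
        (fun t => ENNReal.ofReal (r (he.coord N (g t) • e N - s t • e N))) μ := by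
      simp only [hterm]
      exact ((hg N).aestronglyMeasurable.sub
        s.stronglyMeasurable.aestronglyMeasurable).enorm.const_mul _
    refine ⟨s.map (fun c => c • e N) + G, ?_⟩
    calc ∫⁻ t, ENNReal.ofReal (r (he.proj (Finset.range (N + 1)) (g t) -
            (s.map (fun c => c • e N) + G) t)) ∂μ
        ≤ ∫⁻ t, (ENNReal.ofReal (r (he.coord N (g t) • e N - s t • e N)) +
            ENNReal.ofReal (r (he.proj (Finset.range N) (g t) - G t))) ∂μ := by
          refine lintegral_mono fun t => ?_
          rw [← ENNReal.ofReal_add (apply_nonneg _ _) (apply_nonneg _ _)]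
          refine ENNReal.ofReal_le_ofReal ?_
          have h1 : he.proj (Finset.range (N + 1)) (g t) - (s.map (fun c => c • e N) + G) t =
              (he.coord N (g t) • e N - s t • e N) +
                (he.proj (Finset.range N) (g t) - G t) := by
            rw [proj_apply, proj_apply, Finset.sum_range_succ, SimpleFunc.coe_add, Pi.add_apply,
              SimpleFunc.map_apply]
            abel
          rw [h1]
          exact map_add_le_add _ _ _
      _ = ∫⁻ t, ENNReal.ofReal (r (he.coord N (g t) • e N - s t • e N)) ∂μ +
            ∫⁻ t, ENNReal.ofReal (r (he.proj (Finset.range N) (g t) - G t)) ∂μ :=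
          lintegral_add_left' hmeas _
      _ ≤ ENNReal.ofReal (r (e N)) * ENNReal.ofReal (ε / 2 / (r (e N) + 1)) +
            ENNReal.ofReal (ε / 2) := by
          refine add_le_add ?_ hG
          simp only [hterm]
          rw [lintegral_const_mul' _ _ ENNReal.ofReal_ne_top]
          gcongr
      _ ≤ ENNReal.ofReal ε := by
          rw [← ENNReal.ofReal_mul (apply_nonneg _ _),
            ← ENNReal.ofReal_add (by positivity) (by positivity)]
          refine ENNReal.ofReal_le_ofReal ?_
          have h0 : 0 ≤ r (e N) := apply_nonneg _ _
          have : r (e N) * (ε / 2 / (r (e N) + 1)) ≤ ε / 2 := by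
            rw [mul_div_assoc', div_le_iff₀ (by positivity)]
            nlinarith
          linarith

variable [CompleteSpace E]

theorem IsUnconditional.seminorm_sub_proj_le (hunc : he.IsUnconditional) {r : Seminorm ℝ E}
    (hr : Continuous r) {a x c : E} (h1 : he.le a x) (h2 : he.le x c) (F : Finset ℕ) :
    r (x - he.proj F x) ≤ 6 * he.uncSeminorm r a + 4 * he.uncSeminorm r c := by
  have hA : he.uncSeminorm r (x - he.proj F x) ≤ 2 * he.uncSeminorm r x := by
    refine hunc.uncSeminorm_le_of_abs_coord_le hr fun k => ?_
    rw [coord_sub_proj]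
    split_ifs <;> simp
  have hB : he.uncSeminorm r (x - a) ≤ 2 * he.uncSeminorm r (c - a) := by
    refine hunc.uncSeminorm_le_of_abs_coord_le hr fun k => ?_
    rw [coord_sub, coord_sub, abs_of_nonneg (sub_nonneg.2 (h1 k))]
    exact (sub_le_sub_right (h2 k) _).trans (le_abs_self _)
  have hC := map_add_le_add (he.uncSeminorm r) a (x - a)
  have hD := map_sub_le_add (he.uncSeminorm r) c a
  have hE := hunc.le_uncSeminorm hr (x - he.proj F x)
  rw [add_sub_cancel] at hC
  linarith

variable [T2Space E]

theorem IsUnconditional.integrable_coord (hunc : he.IsUnconditional) [IsFiniteMeasure μ]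
    {p : ℕ → Seminorm ℝ E} (hp : WithSeminorms (p : SeminormFamily ℝ E ℕ)) {a : α → E}
    (ha : FIntegrable p μ a) (k : ℕ) :
    Integrable (fun t => he.coord k (a t)) μ :=
  ((ha.hasFIntegral_fIntegral hp).integrable_and_integral_eq hp
    ⟨he.coordLM k, hunc.continuous_coord hp k⟩).1

theorem IsUnconditional.coord_fIntegral (hunc : he.IsUnconditional) [IsFiniteMeasure μ]
    {p : ℕ → Seminorm ℝ E} (hp : WithSeminorms (p : SeminormFamily ℝ E ℕ)) {a : α → E}
    (ha : FIntegrable p μ a) (k : ℕ) :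
    he.coord k (fIntegral p μ a) = ∫ t, he.coord k (a t) ∂μ :=
  ((ha.hasFIntegral_fIntegral hp).integrable_and_integral_eq hp
    ⟨he.coordLM k, hunc.continuous_coord hp k⟩).2.symm

/-- A function with measurable coordinates that lies between an integrable function and a constant
is integrable: its truncated expansions converge to it in the mean by dominated convergence. -/
theorem IsUnconditional.fIntegrable_of_le_of_le (hunc : he.IsUnconditional) [IsFiniteMeasure μ]
    {p : ℕ → Seminorm ℝ E} (hp : WithSeminorms (p : SeminormFamily ℝ E ℕ)) {a g : α → E} {C : E}
    (ha : FIntegrable p μ a) (hm : ∀ k, AEMeasurable (fun t => he.coord k (g t)) μ)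
    (hag : ∀ᵐ t ∂μ, he.le (a t) (g t)) (hgC : ∀ᵐ t ∂μ, he.le (g t) C) :
    FIntegrable p μ g := by
  have hcoord := hunc.continuous_coord hp
  have hint : ∀ k, Integrable (fun t => he.coord k (g t)) μ := by
    intro k
    refine integrable_of_le_of_le (hm k).aestronglyMeasurable ?_ ?_
      (hunc.integrable_coord hp ha k) (integrable_const (he.coord k C))
    · filter_upwards [hag] with t ht using ht k
    · filter_upwards [hgC] with t ht using ht k
  refine fIntegrable_of_forall_exists_lintegral_le hp fun n ε hε => ?_
  have hr := hp.partial_sups.continuous_seminorm n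
  have hrc := hunc.continuous_uncSeminorm hp.partial_sups n
  set r : Seminorm ℝ E := (Finset.Iic n).sup p
  have hmN : ∀ N, AEMeasurable (fun t => r (g t - he.proj (Finset.range N) (g t))) μ := by
    refine fun N => he.aemeasurable_seminorm hr fun k => ?_
    simp only [coord_sub_proj]
    split_ifs
    · exact aemeasurable_const
    · exact hm k
  have hlim : Tendsto
      (fun N => ∫⁻ t, ENNReal.ofReal (r (g t - he.proj (Finset.range N) (g t))) ∂μ) atTop
      (𝓝 (∫⁻ _, 0 ∂μ)) := by
    refine tendsto_lintegral_of_dominated_convergence'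
      (fun t => ENNReal.ofReal (6 * he.uncSeminorm r (a t)) +
        ENNReal.ofReal (4 * he.uncSeminorm r C)) (fun N => (hmN N).ennreal_ofReal)
      (fun N => ?_) ?_ ?_
    · filter_upwards [hag, hgC] with t h1 h2
      rw [← ENNReal.ofReal_add (by positivity) (by positivity)]
      exact ENNReal.ofReal_le_ofReal (hunc.seminorm_sub_proj_le hr h1 h2 _)
    · rw [lintegral_add_right _ measurable_const]
      simp only [ENNReal.ofReal_mul (show (0 : ℝ) ≤ 6 by norm_num)]
      rw [lintegral_const_mul' _ _ ENNReal.ofReal_ne_top, lintegral_const]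
      exact ENNReal.add_ne_top.2 ⟨ENNReal.mul_ne_top ENNReal.ofReal_ne_top
        (ha.lintegral_seminorm_lt_top hp hrc).ne,
        ENNReal.mul_ne_top ENNReal.ofReal_ne_top (measure_ne_top _ _)⟩
    · refine Eventually.of_forall fun t => ?_
      have h1 : Tendsto (fun N => g t - he.proj (Finset.range N) (g t)) atTop (𝓝 (g t - g t)) := by
        simp only [proj_apply]
        exact tendsto_const_nhds.sub (he.hasExpansion_coord (g t))
      have h2 := (ENNReal.continuous_ofReal.tendsto _).comp ((hr.tendsto _).comp h1)
      rwa [sub_self, map_zero, ENNReal.ofReal_zero] at h2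
  rw [lintegral_zero] at hlim
  obtain ⟨N, hN⟩ := (hlim.eventually_le_const
    (ENNReal.ofReal_pos.2 (show 0 < ε / 2 by positivity))).exists
  obtain ⟨G, hG⟩ := he.exists_simpleFunc_lintegral_proj_le r hint N (half_pos hε)
  refine ⟨G, he.aemeasurable_seminorm hr fun k => ?_, ?_⟩
  · simp only [coord_sub]
    exact (hm k).sub (G.map (he.coord k)).measurable.aemeasurable
  · calc ∫⁻ t, ENNReal.ofReal (r (g t - G t)) ∂μ
        ≤ ∫⁻ t, (ENNReal.ofReal (r (g t - he.proj (Finset.range N) (g t))) +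
            ENNReal.ofReal (r (he.proj (Finset.range N) (g t) - G t))) ∂μ := by
          refine lintegral_mono fun t => ?_
          rw [← ENNReal.ofReal_add (apply_nonneg _ _) (apply_nonneg _ _)]
          refine ENNReal.ofReal_le_ofReal ?_
          have := map_add_le_add r (g t - he.proj (Finset.range N) (g t))
            (he.proj (Finset.range N) (g t) - G t)
          rwa [sub_add_sub_cancel] at this
      _ = ∫⁻ t, ENNReal.ofReal (r (g t - he.proj (Finset.range N) (g t))) ∂μ +
            ∫⁻ t, ENNReal.ofReal (r (he.proj (Finset.range N) (g t) - G t)) ∂μ :=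
          lintegral_add_left' (hmN N).ennreal_ofReal _
      _ ≤ ENNReal.ofReal (ε / 2) + ENNReal.ofReal (ε / 2) := add_le_add hN hG
      _ = ENNReal.ofReal ε := by
          rw [← ENNReal.ofReal_add (by positivity) (by positivity), add_halves]

end OrderBounded

section Superposition

variable {E : Type*} [AddCommGroup E] [Module ℝ E] [UniformSpace E] [IsUniformAddGroup E]
  [ContinuousSMul ℝ E] {e : ℕ → E} {he : IsSchauderBasis e}
  {α : Type*} [MeasurableSpace α] {μ : Measure α}

/-- The element with coordinates `max (aₖ) (zₖ / 2ⁿ)` for `k < n` and `aₖ` for `k ≥ n`. -/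
def dyadicPoint (he : IsSchauderBasis e) (a : E) (n : ℕ) (z : Fin n → ℤ) : E :=
  a + ∑ k ∈ Finset.range n,
    (if h : k < n then max (he.coord k a) (z ⟨k, h⟩ / 2 ^ n) - he.coord k a else 0) • e k

theorem coord_dyadicPoint (he : IsSchauderBasis e) (a : E) (n : ℕ) (z : Fin n → ℤ) (k : ℕ) :
    he.coord k (he.dyadicPoint a n z) =
      if h : k < n then max (he.coord k a) (z ⟨k, h⟩ / 2 ^ n) else he.coord k a := by
  rw [dyadicPoint, coord_add, coord_sum_smul_basis]
  by_cases h : k < n <;> simp [h]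

/-- If `h · x` is measurable for each `x` and each `h t` is left continuous, then `t ↦ h t (u t)` is
measurable for every `u` with measurable coordinates and a lower bound: `u` is the limit of an
increasing sequence of functions with countably many values. -/
theorem IsUnconditional.aemeasurable_superposition [CompleteSpace E] (hunc : he.IsUnconditional)
    {p : ℕ → Seminorm ℝ E} (hp : WithSeminorms (p : SeminormFamily ℝ E ℕ)) {h : α → E → ℝ}
    (hm : ∀ x, AEMeasurable (fun t => h t x) μ) (hleft : ∀ᵐ t ∂μ, he.LeftContinuous (h t))
    {u : α → E} {a : E} (hu : ∀ k, AEMeasurable (fun t => he.coord k (u t)) μ)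
    (hau : ∀ᵐ t ∂μ, he.le a (u t)) : AEMeasurable (fun t => h t (u t)) μ := by
  let z : ∀ n, α → Fin n → ℤ := fun n t k => ⌊he.coord k (u t) * 2 ^ n⌋
  have hz : ∀ n, AEMeasurable (z n) μ := fun n =>
    aemeasurable_pi_lambda _ fun k => Int.measurable_floor.comp_aemeasurable ((hu k).mul_const _)
  refine aemeasurable_of_tendsto_metrizable_ae atTop
    (f := fun n t => h t (he.dyadicPoint a n (z n t))) (fun n => ?_) ?_
  · exact aemeasurable_apply_of_countable (fun w => hm (he.dyadicPoint a n w)) (hz n)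
  · filter_upwards [hleft, hau] with t h1 h2
    refine h1 (u t) _ ?_ fun n k => ?_
    · refine hunc.tendsto_of_tendsto_coord hp (a := a) (b := u t)
        (Eventually.of_forall fun n k => ?_) (Eventually.of_forall fun n k => ?_) h2
        (fun k => le_rfl) fun k => ?_
      · rw [coord_dyadicPoint]
        split_ifs
        · exact le_max_left _ _
        · exact le_rfl
      · rw [coord_dyadicPoint]
        split_ifs
        · refine max_le (h2 k) ?_
          rw [div_le_iff₀ (by positivity)]
          exact Int.floor_le _
        · exact h2 k
      · have hlim := (tendsto_const_nhds (x := he.coord k a)).max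
          (tendsto_floor_div_two_pow (he.coord k (u t)))
        rw [max_eq_right (h2 k)] at hlim
        refine hlim.congr' ?_
        filter_upwards [eventually_gt_atTop k] with n hn
        rw [coord_dyadicPoint, dif_pos hn]
    · rw [coord_dyadicPoint, coord_dyadicPoint]
      by_cases hk : k < n
      · rw [dif_pos hk, dif_pos (Nat.lt_succ_of_lt hk)]
        exact max_le_max le_rfl (floor_div_two_pow_le_succ _ _)
      · rw [dif_neg hk]
        split_ifs
        · exact le_max_left _ _
        · exact le_rfl

end Superposition

end IsSchauderBasis

/-! ### The integral operator and its largest fixed point -/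

theorem aemeasurable_of_lowerSemicontinuousOn {g : ℝ → ℝ} {s : Set ℝ} (hs : MeasurableSet s)
    (hg : LowerSemicontinuousOn g s) : AEMeasurable g (volume.restrict s) := by
  refine aemeasurable_restrict_of_measurable_subtype hs (LowerSemicontinuous.measurable ?_)
  exact lowerSemicontinuous_restrict_iff.2 hg

section Picard

variable {E : Type*} [AddCommGroup E] [Module ℝ E] [UniformSpace E] [IsUniformAddGroup E]
  [ContinuousSMul ℝ E] [T2Space E] [CompleteSpace E] {p : ℕ → Seminorm ℝ E}
  {e : ℕ → E} {he : IsSchauderBasis e} {T : ℝ} {g : ℝ → E} {C : E}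

theorem IsSchauderBasis.IsUnconditional.integrableOn_coord (hunc : he.IsUnconditional)
    (hp : WithSeminorms (p : SeminormFamily ℝ E ℕ)) (hg : IntegrableUpTo p T g) (k : ℕ) :
    IntegrableOn (fun t => he.coord k (g t)) (Icc 0 T) :=
  hunc.integrable_coord hp hg k

theorem IsSchauderBasis.IsUnconditional.coord_integralUpTo (hunc : he.IsUnconditional)
    (hp : WithSeminorms (p : SeminormFamily ℝ E ℕ)) (hg : IntegrableUpTo p T g) {t : ℝ}
    (ht : t ∈ Icc 0 T) (k : ℕ) :
    he.coord k (integralUpTo p t g) = ∫ ξ in Icc 0 t, he.coord k (g ξ) :=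
  hunc.coord_fIntegral hp
    (FIntegrable.mono_measure (Measure.restrict_mono (Icc_subset_Icc_right ht.2) le_rfl) hg) k

/-- The primitive of a function bounded above by `C` is continuous: up to the term `t • C` it is
monotone, hence it stays in an order interval, and there continuity can be checked on the
coordinates. -/
theorem IsSchauderBasis.IsUnconditional.continuousOn_integralUpTo (hunc : he.IsUnconditional)
    (hp : WithSeminorms (p : SeminormFamily ℝ E ℕ)) (hT : 0 ≤ T) (hg : IntegrableUpTo p T g)
    (hC : ∀ t ∈ Icc 0 T, he.le (g t) C) :
    ContinuousOn (fun t => integralUpTo p t g) (Icc 0 T) := by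
  set y : ℝ → E := fun t => t • C - integralUpTo p t g with hy
  have hint := hunc.integrableOn_coord hp hg
  have hcoord : ∀ t ∈ Icc 0 T, ∀ k,
      he.coord k (y t) = ∫ ξ in Icc 0 t, (he.coord k C - he.coord k (g ξ)) := by
    intro t ht k
    rw [hy]
    simp only
    rw [he.coord_sub, he.coord_smul, hunc.coord_integralUpTo hp hg ht,
      integral_sub (integrable_const _) ((hint k).mono_set (Icc_subset_Icc_right ht.2))]
    simp [ht.1]
  have hint' : ∀ k, IntegrableOn (fun ξ => he.coord k C - he.coord k (g ξ)) (Icc 0 T) :=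
    fun k => (integrable_const _).sub (hint k)
  have hnonneg : ∀ k, ∀ ξ ∈ Icc 0 T, 0 ≤ he.coord k C - he.coord k (g ξ) :=
    fun k ξ hξ => sub_nonneg.2 (hC ξ hξ k)
  have hlow : ∀ t ∈ Icc 0 T, he.le 0 (y t) := fun t ht k => by
    rw [he.coord_zero, hcoord t ht]
    exact setIntegral_nonneg measurableSet_Icc fun ξ hξ =>
      hnonneg k ξ (Icc_subset_Icc_right ht.2 hξ)
  have hup : ∀ t ∈ Icc 0 T, he.le (y t) (y T) := fun t ht k => by
    rw [hcoord t ht, hcoord T (right_mem_Icc.2 hT)]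
    refine setIntegral_mono_set (hint' k) ?_ (Icc_subset_Icc_right ht.2).eventuallyLE
    filter_upwards [ae_restrict_mem measurableSet_Icc] with ξ hξ using hnonneg k ξ hξ
  have hcont : ContinuousOn y (Icc 0 T) := fun t₀ ht₀ => by
    refine hunc.tendsto_of_tendsto_coord hp
      (eventually_mem_nhdsWithin.mono hlow) (eventually_mem_nhdsWithin.mono hup)
      (hlow t₀ ht₀) (hup t₀ ht₀) fun k => ?_
    rw [hcoord t₀ ht₀]
    refine (intervalIntegral.continuousOn_primitive_Icc (hint' k) t₀ ht₀).congr' ?_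
    filter_upwards [self_mem_nhdsWithin] with t ht using (hcoord t ht k).symm
  have hsub : ContinuousOn (fun t => t • C - y t) (Icc 0 T) :=
    (continuous_id.smul continuous_const).continuousOn.sub hcont
  simpa [hy] using hsub

variable {f : ℝ → E → E} {x₀ xs : E} {u w : ℝ → E}

theorem IsSchauderBasis.IsUnconditional.coord_picard (hunc : he.IsUnconditional)
    (hp : WithSeminorms (p : SeminormFamily ℝ E ℕ))
    (hu : IntegrableUpTo p T fun t => f t (u t)) {t : ℝ} (ht : t ∈ Icc 0 T) (k : ℕ) :
    he.coord k (picard p f x₀ u t) =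
      he.coord k x₀ + ∫ ξ in Icc 0 t, he.coord k (f ξ (u ξ)) := by
  rw [picard, he.coord_add, hunc.coord_integralUpTo hp hu ht]

theorem IsSchauderBasis.IsUnconditional.picard_mono (hunc : he.IsUnconditional)
    (hp : WithSeminorms (p : SeminormFamily ℝ E ℕ))
    (hmono : ∀ t ∈ Icc 0 T, ∀ x y : E, he.le x y → he.le (f t x) (f t y))
    (hu : IntegrableUpTo p T fun t => f t (u t)) (hw : IntegrableUpTo p T fun t => f t (w t))
    (huw : ∀ t ∈ Icc 0 T, he.le (u t) (w t)) {t : ℝ} (ht : t ∈ Icc 0 T) :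
    he.le (picard p f x₀ u t) (picard p f x₀ w t) := by
  intro k
  have hsub : Icc 0 t ⊆ Icc 0 T := Icc_subset_Icc_right ht.2
  rw [hunc.coord_picard hp hu ht, hunc.coord_picard hp hw ht]
  refine add_le_add_right ?_ _
  exact setIntegral_mono_on ((hunc.integrableOn_coord hp hu k).mono_set hsub)
    ((hunc.integrableOn_coord hp hw k).mono_set hsub) measurableSet_Icc
    fun ξ hξ => hmono ξ (hsub hξ) _ _ (huw ξ (hsub hξ)) k

theorem IsSchauderBasis.IsUnconditional.picard_le (hunc : he.IsUnconditional)
    (hp : WithSeminorms (p : SeminormFamily ℝ E ℕ))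
    (hC : ∀ t ∈ Icc 0 T, ∀ x : E, he.le (f t x) C)
    (hu : IntegrableUpTo p T fun t => f t (u t)) {t : ℝ} (ht : t ∈ Icc 0 T) :
    he.le (picard p f x₀ u t) (x₀ + t • C) := by
  intro k
  have hsub : Icc 0 t ⊆ Icc 0 T := Icc_subset_Icc_right ht.2
  rw [hunc.coord_picard hp hu ht, he.coord_add, he.coord_smul]
  refine add_le_add_right ?_ _
  calc ∫ ξ in Icc 0 t, he.coord k (f ξ (u ξ))
      ≤ ∫ _ in Icc 0 t, he.coord k C :=
        setIntegral_mono_on ((hunc.integrableOn_coord hp hu k).mono_set hsub)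
          (integrable_const _) measurableSet_Icc fun ξ hξ => hC ξ (hsub hξ) _ k
    _ = t * he.coord k C := by simp [ht.1]

theorem IsSchauderBasis.IsUnconditional.continuousOn_picard (hunc : he.IsUnconditional)
    (hp : WithSeminorms (p : SeminormFamily ℝ E ℕ)) (hT : 0 ≤ T)
    (hC : ∀ t ∈ Icc 0 T, ∀ x : E, he.le (f t x) C)
    (hu : IntegrableUpTo p T fun t => f t (u t)) :
    ContinuousOn (picard p f x₀ u) (Icc 0 T) :=
  continuousOn_const.add (hunc.continuousOn_integralUpTo hp hT hu fun t ht => hC t ht _)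

/-- The superposition `t ↦ f(t, u(t))` lies between `f(t, x_*)` and `C`, so its integrability only
requires the measurability of its coordinates. -/
theorem IsSchauderBasis.IsUnconditional.integrableUpTo_superposition (hunc : he.IsUnconditional)
    (hp : WithSeminorms (p : SeminormFamily ℝ E ℕ))
    (hleft : ∀ t ∈ Icc 0 T, ∀ k : ℕ, he.LeftContinuous (fun x => he.coord k (f t x)))
    (hint : ∀ x : E, IntegrableUpTo p T (fun t => f t x))
    (hC : ∀ t ∈ Icc 0 T, ∀ x : E, he.le (f t x) C)
    (hmono : ∀ t ∈ Icc 0 T, ∀ x y : E, he.le x y → he.le (f t x) (f t y))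
    (hu : ∀ k, LowerSemicontinuousOn (fun t => he.coord k (u t)) (Icc 0 T))
    (hxu : ∀ t ∈ Icc 0 T, he.le xs (u t)) : IntegrableUpTo p T fun t => f t (u t) := by
  have hmem : ∀ᵐ t ∂volume.restrict (Icc 0 T), t ∈ Icc 0 T := ae_restrict_mem measurableSet_Icc
  refine hunc.fIntegrable_of_le_of_le hp (hint xs) (C := C) (fun k => ?_) ?_ ?_
  · refine hunc.aemeasurable_superposition hp (h := fun t x => he.coord k (f t x)) (a := xs)
      (fun x => (hunc.integrableOn_coord hp (hint x) k).aemeasurable)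
      (hmem.mono fun t ht => hleft t ht k)
      (fun k => aemeasurable_of_lowerSemicontinuousOn measurableSet_Icc (hu k))
      (hmem.mono hxu)
  · exact hmem.mono fun t ht => hmono t ht _ _ (hxu t ht)
  · exact hmem.mono fun t ht => hC t ht _

end Picard

end FrechetIVP

end

theorem theorem2p2 {E : Type*} [AddCommGroup E] [Module ℝ E]
    [UniformSpace E] [IsUniformAddGroup E] [ContinuousSMul ℝ E] [T2Space E] [CompleteSpace E]
    (p : ℕ → Seminorm ℝ E) (hp : WithSeminorms (p : SeminormFamily ℝ E ℕ))
    (e : ℕ → E) (he : FrechetIVP.IsSchauderBasis e) (hunc : he.IsUnconditional)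
    (T : ℝ) (hT : 0 < T) (f : ℝ → E → E) (x₀ : E)
    (hleft : ∀ t ∈ Icc 0 T, ∀ k : ℕ, he.LeftContinuous (fun x => he.coord k (f t x)))
    (hint : ∀ x : E, FrechetIVP.IntegrableUpTo p T (fun t => f t x))
    (C : E) (hC : ∀ t ∈ Icc 0 T, ∀ x : E, he.le (f t x) C)
    (xs : E) (hxs : ∀ t ∈ Icc 0 T,
      he.le xs (x₀ + FrechetIVP.integralUpTo p t (fun ξ => f ξ xs)))
    (hmono : ∀ t ∈ Icc 0 T, ∀ x y : E, he.le x y → he.le (f t x) (f t y)) :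
    ∃ xbar : ℝ → E,
      (∀ t ∈ Icc 0 T,
        he.HasSup {y | ∃ v, FrechetIVP.IsSolution p T f x₀ v ∧ y = v t} (xbar t)) ∧
      FrechetIVP.IsSolution p T f x₀ xbar ∧
      (∀ v, FrechetIVP.IsSolution p T f x₀ v → ∀ t ∈ Icc 0 T, he.le (v t) (xbar t)) ∧
      (∀ t ∈ Icc 0 T,
        he.HasSup {y | ∃ u, FrechetIVP.IsSubsolution he p T f x₀ xs u ∧ y = u t} (xbar t)) := by
  have hsup : ∀ {u : ℝ → E}, (∀ k, LowerSemicontinuousOn (fun t => he.coord k (u t)) (Icc 0 T)) →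
      (∀ t ∈ Icc 0 T, he.le xs (u t)) → FrechetIVP.IntegrableUpTo p T fun t => f t (u t) :=
    fun hu hxu => hunc.integrableUpTo_superposition hp hleft hint hC hmono hu hxu
  have hsub_xs : FrechetIVP.IsSubsolution he p T f x₀ xs fun _ => xs :=
    ⟨fun _ => lowerSemicontinuousOn_const, hint xs, fun _ _ _ => le_rfl, hxs⟩
  -- the coordinatewise supremum of all subsolutions
  let V : ℝ → Set E := fun t => {y | ∃ u, FrechetIVP.IsSubsolution he p T f x₀ xs u ∧ y = u t}
  have hVne : ∀ t k, (he.coord k '' V t).Nonempty := fun t k =>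
    ⟨_, xs, ⟨_, hsub_xs, rfl⟩, rfl⟩
  have hVle : ∀ t ∈ Icc 0 T, ∀ k, he.coord k (x₀ + t • C) ∈ upperBounds (he.coord k '' V t) := by
    rintro t ht k _ ⟨_, ⟨u, hu, rfl⟩, rfl⟩
    exact (hu.upper t ht k).trans (hunc.picard_le hp hC hu.integrable ht k)
  have hVlub : ∀ t ∈ Icc 0 T, ∀ k, IsLUB (he.coord k '' V t) (sSup (he.coord k '' V t)) :=
    fun t ht k => isLUB_csSup (hVne t k) ⟨_, hVle t ht k⟩
  have hex : ∀ t, ∃ y, t ∈ Icc 0 T → ∀ k, he.coord k y = sSup (he.coord k '' V t) := by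
    intro t
    by_cases ht : t ∈ Icc 0 T
    · obtain ⟨y, hy⟩ := hunc.exists_coord_eq_of_le_of_le hp (a := xs) (b := x₀ + t • C)
        (fun k => (hVlub t ht k).1 ⟨xs, ⟨_, hsub_xs, rfl⟩, rfl⟩)
        (fun k => (hVlub t ht k).2 (hVle t ht k))
      exact ⟨y, fun _ => hy⟩
    · exact ⟨0, fun h => absurd h ht⟩
  choose xbar hxbar using hex
  have hlub : ∀ t ∈ Icc 0 T, ∀ k, IsLUB (he.coord k '' V t) (he.coord k (xbar t)) :=
    fun t ht k => by rw [hxbar t ht k]; exact hVlub t ht k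
  have hle : ∀ u, FrechetIVP.IsSubsolution he p T f x₀ xs u → ∀ t ∈ Icc 0 T,
      he.le (u t) (xbar t) := fun u hu t ht k => (hlub t ht k).1 ⟨_, ⟨u, hu, rfl⟩, rfl⟩
  have hlsc : ∀ k, LowerSemicontinuousOn (fun t => he.coord k (xbar t)) (Icc 0 T) := by
    intro k t ht c hc
    obtain ⟨_, ⟨_, ⟨u, hu, rfl⟩, rfl⟩, hcu⟩ := (lt_isLUB_iff (hlub t ht k)).1 hc
    filter_upwards [hu.lsc k t ht c hcu, self_mem_nhdsWithin] with s hs hsT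
    exact hs.trans_le (hle u hu s hsT k)
  have hlow : ∀ t ∈ Icc 0 T, he.le xs (xbar t) := hle _ hsub_xs
  have hxint := hsup hlsc hlow
  have hup : ∀ t ∈ Icc 0 T, he.le (xbar t) (FrechetIVP.picard p f x₀ xbar t) := by
    intro t ht k
    refine (hlub t ht k).2 ?_
    rintro _ ⟨_, ⟨u, hu, rfl⟩, rfl⟩
    exact (hu.upper t ht k).trans
      (hunc.picard_mono hp hmono hu.integrable hxint (hle u hu) ht k)
  -- `Φ(x̄)` is a subsolution as well, which gives the reverse inequality
  have hcont : ContinuousOn (FrechetIVP.picard p f x₀ xbar) (Icc 0 T) :=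
    hunc.continuousOn_picard hp hT.le hC hxint
  have hlsc_of_cont : ∀ {v : ℝ → E}, ContinuousOn v (Icc 0 T) → ∀ k,
      LowerSemicontinuousOn (fun t => he.coord k (v t)) (Icc 0 T) := fun hv k =>
    ((hunc.continuous_coord hp k).comp_continuousOn hv).lowerSemicontinuousOn
  have hlow' : ∀ t ∈ Icc 0 T, he.le xs (FrechetIVP.picard p f x₀ xbar t) :=
    fun t ht k => (hlow t ht k).trans (hup t ht k)
  have hpint := hsup (hlsc_of_cont hcont) hlow'
  have hfix : ∀ t ∈ Icc 0 T, xbar t = FrechetIVP.picard p f x₀ xbar t := by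
    intro t ht
    refine he.ext_coord fun k => le_antisymm (hup t ht k) (hle _ ?_ t ht k)
    exact ⟨hlsc_of_cont hcont, hpint, hlow', fun t ht =>
      hunc.picard_mono hp hmono hxint hpint hup ht⟩
  have hsol : FrechetIVP.IsSolution p T f x₀ xbar := ⟨hcont.congr hfix, hxint, hfix⟩
  have hmax : ∀ v, FrechetIVP.IsSolution p T f x₀ v → ∀ t ∈ Icc 0 T, he.le (v t) (xbar t) := by
    intro v hv
    -- a solution need not lie above `x_*`, but `max(x_*, v)` is a subsolution
    choose w hw using fun t => hunc.exists_coord_eq_max hp xs (v t)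
    have hxw : ∀ t ∈ Icc 0 T, he.le xs (w t) := fun t _ k => by rw [hw]; exact le_max_left _ _
    have hvw : ∀ t ∈ Icc 0 T, he.le (v t) (w t) := fun t _ k => by rw [hw]; exact le_max_right _ _
    have hwlsc : ∀ k, LowerSemicontinuousOn (fun t => he.coord k (w t)) (Icc 0 T) := fun k => by
      simp only [hw]
      exact ((continuous_const.max (hunc.continuous_coord hp k)).comp_continuousOn
        hv.continuousOn).lowerSemicontinuousOn
    have hwint := hsup hwlsc hxw
    have hwsub : FrechetIVP.IsSubsolution he p T f x₀ xs w := by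
      refine ⟨hwlsc, hwint, hxw, fun t ht k => ?_⟩
      rw [hw]
      refine max_le ?_ ?_
      · exact (hxs t ht k).trans (hunc.picard_mono hp hmono (hint xs) hwint hxw ht k)
      · rw [hv.eq_picard t ht]
        exact hunc.picard_mono hp hmono hv.integrable hwint hvw ht k
    exact fun t ht k => (hvw t ht k).trans (hle w hwsub t ht k)
  refine ⟨xbar, fun t ht => he.hasSup_of_forall_isLUB fun k => IsGreatest.isLUB ⟨?_, ?_⟩, hsol,
    hmax, fun t ht => he.hasSup_of_forall_isLUB (hlub t ht)⟩
  · exact ⟨_, ⟨xbar, hsol, rfl⟩, rfl⟩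
  · rintro _ ⟨_, ⟨v, hv, rfl⟩, rfl⟩
    exact hmax v hv t ht k
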